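/- Let $\Bbbk$ be a field. All algebras are $\mathbb N$-graded $\Bbbk$-algebras, modules are $\mathbb Z$-graded left modules, and "noetherian" means left and right noetherian. An algebra $A$ is connected graded if $A_0=\Bbbk$; then $\Bbbk=A/A_{\ge 1}$ is the trivial module. A connected graded algebra $T$ is Artin–Schelter (AS) regular if, for some $d\in\mathbb N$ and $\mathfrak l\in\mathbb Z$, it has injective dimension $d$ on the left and on the right, $\operatorname{Ext}^i_T({}_T\Bbbk,{}_TT)=\operatorname{Ext}^i_T(\Bbbk_T,T_T)=0$ for $i\ne d$, $\operatorname{Ext}^d_T({}_T\Bbbk,{}_TT)\cong\operatorname{Ext}^d_T(\Bbbk_T,T_T)\cong\Bbbk(\mathfrak l)$, and it has finite global dimension and finite Gelfand–Kirillov dimension. For a graded left $A$-module $M$ put $$t^A_i({}_AM)=\sup\{j\mid \operatorname{Tor}^A_i(\Bbbk,M)_j\neq 0\},\qquad \operatorname{Torreg}({}_AM)=\sup\{j-i\mid \operatorname{Tor}^A_i(\Bbbk,M)_j\ne0\}$$ in $\mathbb Z\cup\{\pm\infty\}$, with $\sup\emptyset=-\infty$ and $(-\infty)+x=-\infty$ for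 every $x$. The module $M$ is linear if it has a minimal free resolution $\cdots\to A(-i)^{\beta_i}\to\cdots\to A(-1)^{\beta_1}\to A^{\beta_0}\to M\to 0$ with integers $\beta_i\geq 0$; $A$ is Koszul if ${}_A\Bbbk$ is linear. **Lemma 4.3.** Let $T$ be a noetherian AS regular algebra, let $A$ be a noetherian connected graded algebra, and let $\phi:T\to A$ be a homomorphism of graded $\Bbbk$-algebras which is finite, that is, ${}_TA$ and $A_T$ are finitely generated. 1. For every finitely generated graded left $A$-module $M$, $\operatorname{Torreg}({}_TM)\le\operatorname{Torreg}({}_TA)+\operatorname{Torreg}({}_AM)$. Assume moreover that ${}_TA$ is linear. Then: 2. For all $s\ge0$, $t^T_s(\Bbbk)-s\le\max_{0\le i\le s}\{t^A_i(\Bbbk)-i\}$. 3. For all $0\le s\le\operatorname{gldim}T$, $\max_{0\le i\le s}\{t^A_i(\Bbbk)-i\}=\max_{0\le i\le s}\{t^T_i(\Bbbk)-i\}$. 4. For all $j>\operatorname{gldim}T$, $t^A_j(\Bbbk)-j\le\operatorname{Torreg}({}_T\Bbbk)$; moreover $\operatorname{Torreg}({}_T\Bbbk)=\max_{0\le i\le\operatorname{gldim}T}\{t^T_i(\Bbbk)-i\}$.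 5. $\operatorname{Torreg}({}_A\Bbbk)=\operatorname{Torreg}({}_T\Bbbk)$. Consequently $A$ is Koszul if and only if $T$ is Koszul. -/

import Mathlib

open CategoryTheory CategoryTheory.Limits

universe u w

/-- A family of subobjects with projections is an internal direct sum decomposition. -/
theorem isInternal_of_proj {ι M σ : Type*} [DecidableEq ι] [AddCommGroup M] [SetLike σ M]
    [AddSubmonoidClass σ M] (D : ι → σ) (p : ι → M →+ M)
    (h1 : ∀ n, ∀ x ∈ D n, p n x = x) (h2 : ∀ m n, m ≠ n → ∀ x ∈ D m, p n x = 0)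
    (h3 : ∀ x, x ∈ AddSubmonoid.closure (⋃ n, (D n : Set M))) :
    DirectSum.IsInternal D := by
  have key : ∀ (y : DirectSum ι (fun i => D i)) (n : ι),
      p n (DirectSum.coeAddMonoidHom D y) = (y n : M) := by
    intro y n
    induction y using DirectSum.induction_on with
    | zero => simp
    | of i x =>
      rw [DirectSum.coeAddMonoidHom_of]
      by_cases h : i = n
      · subst h
        rw [h1 _ _ x.2, DirectSum.of_eq_same]
      · rw [h2 _ _ h _ x.2, DirectSum.of_eq_of_ne _ _ _ (Ne.symm h)]
        rfl
    | add x y hx hy => rw [map_add, map_add, hx, hy]; simp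
  constructor
  · intro x y hxy
    refine DFinsupp.ext fun n => Subtype.ext ?_
    rw [← key x n, ← key y n, hxy]
  · intro x
    have : AddSubmonoid.closure (⋃ n, (D n : Set M)) ≤
        AddMonoidHom.mrange (DirectSum.coeAddMonoidHom D) := by
      rw [AddSubmonoid.closure_le]
      intro y hy
      obtain ⟨n, hn⟩ := Set.mem_iUnion.1 hy
      exact ⟨DirectSum.of (fun i => D i) n ⟨y, hn⟩, DirectSum.coeAddMonoidHom_of _ _ _⟩
    exact this (h3 x)

section Graded

variable {k : Type w} {A : Type u} [Field k] [Ring A] [Algebra k A]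

/-- The graded pieces of an `ℕ`-graded algebra, indexed by `ℤ`: zero in negative degrees. -/
def gradedPiece (𝒜 : ℕ → Submodule k A) : ℤ → Submodule k A
  | Int.ofNat n => 𝒜 n
  | Int.negSucc _ => ⊥

/-- A `ℤ`-graded left module over an `ℕ`-graded algebra. -/
structure GrMod (𝒜 : ℕ → Submodule k A) where
  /-- the underlying left module -/
  carrier : Type u
  [addCommGroup : AddCommGroup carrier]
  [module : Module A carrier]
  /-- the homogeneous components -/
  deg : ℤ → AddSubgroup carrier
  isInternal : DirectSum.IsInternal deg
  smul_mem : ∀ (i : ℕ) (j : ℤ) (a : A) (x : carrier),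
    a ∈ 𝒜 i → x ∈ deg j → a • x ∈ deg ((i : ℤ) + j)

attribute [instance] GrMod.addCommGroup GrMod.module

namespace GrMod

variable {𝒜 : ℕ → Submodule k A}

/-- The projection of a graded module onto its component of degree `n`. -/
noncomputable def proj (M : GrMod 𝒜) (n : ℤ) : M.carrier →+ M.carrier :=
  ((M.deg n).subtype.comp (DFinsupp.evalAddMonoidHom n)).comp
    (AddEquiv.ofBijective (DirectSum.coeAddMonoidHom M.deg) M.isInternal).symm.toAddMonoidHom

theorem proj_coe (M : GrMod 𝒜) (n : ℤ) (y : DirectSum ℤ fun i => M.deg i) :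
    M.proj n (DirectSum.coeAddMonoidHom M.deg y) = (y n : M.carrier) := by
  have : (AddEquiv.ofBijective (DirectSum.coeAddMonoidHom M.deg) M.isInternal).symm
      (DirectSum.coeAddMonoidHom M.deg y) = y :=
    (AddEquiv.ofBijective (DirectSum.coeAddMonoidHom M.deg) M.isInternal).symm_apply_apply y
  change (((AddEquiv.ofBijective (DirectSum.coeAddMonoidHom M.deg) M.isInternal).symm
      (DirectSum.coeAddMonoidHom M.deg y)) n : M.carrier) = _
  rw [this]

theorem proj_mem (M : GrMod 𝒜) (n : ℤ) (x : M.carrier) : M.proj n x ∈ M.deg n :=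
  SetLike.coe_mem _

theorem proj_same (M : GrMod 𝒜) (n : ℤ) {x : M.carrier} (hx : x ∈ M.deg n) :
    M.proj n x = x := by
  have := M.proj_coe n (DirectSum.of (fun i => M.deg i) n ⟨x, hx⟩)
  rwa [DirectSum.coeAddMonoidHom_of, DirectSum.of_eq_same] at this

theorem proj_ne (M : GrMod 𝒜) {m n : ℤ} (h : m ≠ n) {x : M.carrier} (hx : x ∈ M.deg m) :
    M.proj n x = 0 := by
  have := M.proj_coe n (DirectSum.of (fun i => M.deg i) m ⟨x, hx⟩)
  rw [DirectSum.coeAddMonoidHom_of, DirectSum.of_eq_of_ne _ _ _ (Ne.symm h)] at this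
  simpa using this

theorem mem_closure (M : GrMod 𝒜) (x : M.carrier) :
    x ∈ AddSubmonoid.closure (⋃ n, (M.deg n : Set M.carrier)) := by
  obtain ⟨y, rfl⟩ := M.isInternal.2 x
  induction y using DirectSum.induction_on with
  | zero => simp
  | of i x =>
    rw [DirectSum.coeAddMonoidHom_of]
    exact AddSubmonoid.subset_closure (Set.mem_iUnion.2 ⟨i, x.2⟩)
  | add x y hx hy => rw [map_add]; exact add_mem hx hy

theorem induction_hom (M : GrMod 𝒜) {p : M.carrier → Prop} (x : M.carrier) (h0 : p 0)
    (hadd : ∀ x y, p x → p y → p (x + y)) (hhom : ∀ n, ∀ x ∈ M.deg n, p x) : p x := by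
  induction M.mem_closure x using AddSubmonoid.closure_induction with
  | mem x hx =>
    obtain ⟨n, hn⟩ := Set.mem_iUnion.1 hx
    exact hhom n x hn
  | zero => exact h0
  | add x y _ _ hx hy => exact hadd x y hx hy

theorem exists_sum_proj (M : GrMod 𝒜) (x : M.carrier) :
    ∃ s : Finset ℤ, x = ∑ n ∈ s, M.proj n x := by
  classical
  suffices h : ∃ s : Finset ℤ, ∀ t : Finset ℤ, s ⊆ t → x = ∑ n ∈ t, M.proj n x by
    obtain ⟨s, hs⟩ := h
    exact ⟨s, hs s (Finset.Subset.refl s)⟩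
  refine M.induction_hom (p := fun x => ∃ s : Finset ℤ, ∀ t : Finset ℤ, s ⊆ t →
    x = ∑ n ∈ t, M.proj n x) x ⟨∅, by simp⟩ ?_ ?_
  · rintro x y ⟨s, hs⟩ ⟨t, ht⟩
    refine ⟨s ∪ t, fun r hr => ?_⟩
    simp only [map_add, Finset.sum_add_distrib]
    rw [← hs r (Finset.union_subset_left hr), ← ht r (Finset.union_subset_right hr)]
  · intro n x hx
    refine ⟨{n}, fun t ht => ?_⟩
    rw [Finset.sum_eq_single n, M.proj_same n hx]
    · intro b _ hb
      exact M.proj_ne (Ne.symm hb) hx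
    · intro h
      exact absurd (ht (Finset.mem_singleton_self n)) h

/-- The group of graded homomorphisms of degree zero. -/
def homSubgroup (M N : GrMod 𝒜) : AddSubgroup (M.carrier →ₗ[A] N.carrier) where
  carrier := {f | ∀ (n : ℤ), ∀ x ∈ M.deg n, f x ∈ N.deg n}
  zero_mem' := fun n _ _ => (N.deg n).zero_mem
  add_mem' := fun hf hg n x hx => (N.deg n).add_mem (hf n x hx) (hg n x hx)
  neg_mem' := fun hf n x hx => (N.deg n).neg_mem (hf n x hx)

/-- The category of `ℤ`-graded left modules and homomorphisms of degree zero. -/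
instance : Category.{u} (GrMod 𝒜) where
  Hom M N := homSubgroup M N
  id M := ⟨LinearMap.id, fun _ _ hx => hx⟩
  comp f g := ⟨g.1.comp f.1, fun n x hx => g.2 n _ (f.2 n x hx)⟩

/-- The underlying linear map of a morphism. -/
def lin {M N : GrMod 𝒜} (f : M ⟶ N) : M.carrier →ₗ[A] N.carrier := f.1

/-- A linear map preserving degrees, as a morphism. -/
def mkHom {M N : GrMod 𝒜} (f : M.carrier →ₗ[A] N.carrier)
    (hf : ∀ (n : ℤ), ∀ x ∈ M.deg n, f x ∈ N.deg n) : M ⟶ N := ⟨f, hf⟩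

theorem lin_mem {M N : GrMod 𝒜} (f : M ⟶ N) (n : ℤ) {x : M.carrier} (hx : x ∈ M.deg n) :
    lin f x ∈ N.deg n := f.2 n x hx

@[ext] theorem hom_ext {M N : GrMod 𝒜} {f g : M ⟶ N} (h : ∀ x, lin f x = lin g x) : f = g :=
  Subtype.ext (LinearMap.ext h)

@[simp] theorem lin_mkHom {M N : GrMod 𝒜} (f : M.carrier →ₗ[A] N.carrier)
    (hf : ∀ (n : ℤ), ∀ x ∈ M.deg n, f x ∈ N.deg n) : lin (mkHom f hf) = f := rfl

@[simp] theorem lin_id (M : GrMod 𝒜) : lin (𝟙 M) = LinearMap.id := rfl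

@[simp] theorem lin_comp {M N P : GrMod 𝒜} (f : M ⟶ N) (g : N ⟶ P) :
    lin (f ≫ g) = (lin g).comp (lin f) := rfl

instance (M N : GrMod 𝒜) : AddCommGroup (M ⟶ N) :=
  inferInstanceAs (AddCommGroup (homSubgroup M N))

@[simp] theorem lin_add {M N : GrMod 𝒜} (f g : M ⟶ N) : lin (f + g) = lin f + lin g := rfl

instance : Preadditive (GrMod 𝒜) where
  add_comp := by
    intros
    ext
    simp
  comp_add := by
    intros
    ext
    simp

@[simp] theorem lin_zero {M N : GrMod 𝒜} : lin (0 : M ⟶ N) = 0 := rfl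

theorem proj_lin {M N : GrMod 𝒜} (f : M ⟶ N) (n : ℤ) (x : M.carrier) :
    N.proj n (lin f x) = lin f (M.proj n x) := by
  refine M.induction_hom (p := fun x => N.proj n (lin f x) = lin f (M.proj n x)) x (by simp)
    (fun x y hx hy => by simp [hx, hy]) ?_
  intro m x hx
  by_cases h : m = n
  · subst h
    rw [M.proj_same _ hx, N.proj_same _ (lin_mem f _ hx)]
  · rw [M.proj_ne h hx, N.proj_ne h (lin_mem f _ hx), map_zero]

/-- A homogeneous submodule of a graded module, as a graded module. -/
def sub (M : GrMod 𝒜) (N : Submodule A M.carrier) (hN : ∀ n, ∀ x ∈ N, M.proj n x ∈ N) :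
    GrMod 𝒜 where
  carrier := N
  deg n := (M.deg n).comap N.subtype.toAddMonoidHom
  isInternal := by
    refine isInternal_of_proj _ (fun n => ((M.proj n).comp N.subtype.toAddMonoidHom).codRestrict
      N (fun x => hN n _ x.2)) ?_ ?_ ?_
    · intro n x hx
      exact Subtype.ext (M.proj_same n hx)
    · intro m n h x hx
      exact Subtype.ext (M.proj_ne h hx)
    · intro x
      obtain ⟨s, hs⟩ := M.exists_sum_proj x.1
      have : x = ∑ n ∈ s, (⟨M.proj n x.1, hN n _ x.2⟩ : N) := by
        refine Subtype.ext ?_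
        rw [AddSubmonoidClass.coe_finsetSum]
        exact hs
      rw [this]
      exact sum_mem fun n _ => AddSubmonoid.subset_closure
        (Set.mem_iUnion.2 ⟨n, M.proj_mem n x.1⟩)
  smul_mem i j a x ha hx := M.smul_mem i j a x ha hx

/-- The quotient of a graded module by a homogeneous submodule. -/
def quot (M : GrMod 𝒜) (N : Submodule A M.carrier) (hN : ∀ n, ∀ x ∈ N, M.proj n x ∈ N) :
    GrMod 𝒜 where
  carrier := M.carrier ⧸ N
  deg n := (M.deg n).map N.mkQ.toAddMonoidHom
  isInternal := by
    refine isInternal_of_proj _ (fun n => QuotientAddGroup.map N.toAddSubgroup N.toAddSubgroup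
      (M.proj n) (fun x hx => hN n x hx)) ?_ ?_ ?_
    · rintro n _ ⟨x, hx, rfl⟩
      exact congrArg N.mkQ (M.proj_same n hx)
    · rintro m n h _ ⟨x, hx, rfl⟩
      exact (congrArg N.mkQ (M.proj_ne h hx)).trans (map_zero _)
    · intro x
      obtain ⟨x, rfl⟩ := N.mkQ_surjective x
      refine M.induction_hom (p := fun x => N.mkQ x ∈ AddSubmonoid.closure _) x
        (by rw [map_zero]; exact zero_mem _)
        (fun x y hx hy => by rw [map_add]; exact add_mem hx hy) ?_
      intro n x hx
      exact AddSubmonoid.subset_closure (Set.mem_iUnion.2 ⟨n, x, hx, rfl⟩)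
  smul_mem := by
    rintro i j a _ ha ⟨x, hx, rfl⟩
    exact ⟨a • x, M.smul_mem i j a x ha hx, rfl⟩

/-- The degree shift `M(l)`, with `M(l)_n = M_{n+l}`. -/
def shift (M : GrMod 𝒜) (l : ℤ) : GrMod 𝒜 where
  carrier := M.carrier
  deg n := M.deg (n + l)
  isInternal := by
    refine isInternal_of_proj _ (fun n => M.proj (n + l)) ?_ ?_ ?_
    · intro n x hx
      exact M.proj_same _ hx
    · intro m n h x hx
      exact M.proj_ne (fun h' => h (by omega)) hx
    · intro x
      refine M.induction_hom (p := fun x => x ∈ AddSubmonoid.closure _) x (zero_mem _)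
        (fun x y hx hy => add_mem hx hy) ?_
      intro n x hx
      refine AddSubmonoid.subset_closure (Set.mem_iUnion.2 ⟨n - l, ?_⟩)
      simpa using hx
  smul_mem i j a x ha hx := by
    have := M.smul_mem i (j + l) a x ha hx
    rwa [← add_assoc] at this

/-- The direct sum of two graded modules. -/
def prod (M N : GrMod 𝒜) : GrMod 𝒜 where
  carrier := M.carrier × N.carrier
  deg n := (M.deg n).prod (N.deg n)
  isInternal := by
    refine isInternal_of_proj _ (fun n => (M.proj n).prodMap (N.proj n)) ?_ ?_ ?_
    · intro n x hx
      exact Prod.ext (M.proj_same n hx.1) (N.proj_same n hx.2)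
    · intro m n h x hx
      exact Prod.ext (M.proj_ne h hx.1) (N.proj_ne h hx.2)
    · rintro ⟨x, y⟩
      have h : ((x, y) : M.carrier × N.carrier) = (x, 0) + (0, y) := by simp
      rw [h]
      refine add_mem ?_ ?_
      · refine M.induction_hom
          (p := fun x => ((x, 0) : M.carrier × N.carrier) ∈ AddSubmonoid.closure _) x (zero_mem _) (fun x y hx hy => ?_) ?_
        · have : ((x + y, 0) : M.carrier × N.carrier) = (x, 0) + (y, 0) := by simp
          rw [this]
          exact add_mem hx hy
        · intro n x hx
          exact AddSubmonoid.subset_closure (Set.mem_iUnion.2 ⟨n, hx, zero_mem _⟩)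
      · refine N.induction_hom
          (p := fun y => ((0, y) : M.carrier × N.carrier) ∈ AddSubmonoid.closure _) y (zero_mem _) (fun x y hx hy => ?_) ?_
        · have : ((0, x + y) : M.carrier × N.carrier) = (0, x) + (0, y) := by simp
          rw [this]
          exact add_mem hx hy
        · intro n x hx
          exact AddSubmonoid.subset_closure (Set.mem_iUnion.2 ⟨n, zero_mem _, hx⟩)
  smul_mem i j a x ha hx := ⟨M.smul_mem i j a _ ha hx.1, N.smul_mem i j a _ ha hx.2⟩

/-- The zero graded module. -/
def zero (𝒜 : ℕ → Submodule k A) : GrMod 𝒜 where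
  carrier := PUnit
  deg _ := ⊥
  isInternal := by
    refine isInternal_of_proj _ (fun _ => 0) ?_ ?_ ?_
    · intro n x _
      exact Subsingleton.elim _ _
    · intro m n _ x _
      exact Subsingleton.elim _ _
    · intro x
      rw [Subsingleton.elim x 0]
      exact zero_mem _
  smul_mem i j a x _ _ := by
    rw [Subsingleton.elim (a • x) 0]
    exact zero_mem _

instance : HasZeroObject (GrMod 𝒜) :=
  ⟨zero 𝒜, ⟨fun Y => ⟨⟨⟨0⟩, fun f => hom_ext fun x => by
      rw [show x = 0 from Subsingleton.elim (α := PUnit) _ _, map_zero, map_zero]⟩⟩,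
    fun Y => ⟨⟨⟨0⟩, fun f => hom_ext fun x => Subsingleton.elim (α := PUnit) _ _⟩⟩⟩⟩

instance : HasBinaryBiproducts (GrMod 𝒜) :=
  ⟨fun M N => hasBinaryBiproduct_of_total
    { pt := prod M N
      fst := mkHom (LinearMap.fst A M.carrier N.carrier) fun _ _ hx => hx.1
      snd := mkHom (LinearMap.snd A M.carrier N.carrier) fun _ _ hx => hx.2
      inl := mkHom (LinearMap.inl A M.carrier N.carrier) fun _ _ hx => ⟨hx, zero_mem _⟩
      inr := mkHom (LinearMap.inr A M.carrier N.carrier) fun _ _ hx => ⟨zero_mem _, hx⟩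
      inl_fst := rfl
      inl_snd := rfl
      inr_fst := rfl
      inr_snd := rfl }
    (hom_ext fun x => by
      change ((x.1, 0) : M.carrier × N.carrier) + (0, x.2) = (x.1, x.2)
      simp)⟩

instance : HasFiniteProducts (GrMod 𝒜) :=
  hasFiniteProducts_of_has_binary_and_terminal

theorem ker_homogeneous {M N : GrMod 𝒜} (f : M ⟶ N) :
    ∀ n, ∀ x ∈ LinearMap.ker (lin f), M.proj n x ∈ LinearMap.ker (lin f) := by
  intro n x hx
  rw [LinearMap.mem_ker] at hx ⊢
  rw [← proj_lin, hx, map_zero]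

theorem range_homogeneous {M N : GrMod 𝒜} (f : M ⟶ N) :
    ∀ n, ∀ x ∈ LinearMap.range (lin f), N.proj n x ∈ LinearMap.range (lin f) := by
  rintro n _ ⟨x, rfl⟩
  exact ⟨M.proj n x, (proj_lin f n x).symm⟩

/-- The kernel of a morphism. -/
def ker {M N : GrMod 𝒜} (f : M ⟶ N) : GrMod 𝒜 := M.sub (LinearMap.ker (lin f)) (ker_homogeneous f)

/-- The inclusion of the kernel. -/
def kerι {M N : GrMod 𝒜} (f : M ⟶ N) : ker f ⟶ M :=
  mkHom (M := ker f) (LinearMap.ker (lin f)).subtype fun _ _ hx => hx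

/-- The cokernel of a morphism. -/
def coker {M N : GrMod 𝒜} (f : M ⟶ N) : GrMod 𝒜 :=
  N.quot (LinearMap.range (lin f)) (range_homogeneous f)

/-- The projection onto the cokernel. -/
def cokerπ {M N : GrMod 𝒜} (f : M ⟶ N) : N ⟶ coker f :=
  mkHom (N := coker f) (LinearMap.range (lin f)).mkQ fun _ x hx => ⟨x, hx, rfl⟩

theorem kerι_comp {M N : GrMod 𝒜} (f : M ⟶ N) : kerι f ≫ f = 0 := hom_ext fun x => x.2

theorem comp_cokerπ {M N : GrMod 𝒜} (f : M ⟶ N) : f ≫ cokerπ f = 0 :=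
  hom_ext fun x => (Submodule.Quotient.mk_eq_zero _).2 ⟨x, rfl⟩

/-- An injective morphism whose image is the kernel of `g` is a categorical kernel of `g`. -/
noncomputable def isLimitOfExact {K M N : GrMod 𝒜} (i : K ⟶ M) (g : M ⟶ N) (w : i ≫ g = 0)
    (hi : Function.Injective (lin i)) (hex : ∀ x, lin g x = 0 → ∃ y, lin i y = x) :
    IsLimit (KernelFork.ofι i w) :=
  KernelFork.IsLimit.ofι i w
    (fun {W} t ht => mkHom
      ((LinearEquiv.ofInjective (lin i) hi).symm.toLinearMap.comp
        ((lin t).codRestrict (LinearMap.range (lin i)) fun x =>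
          hex _ (congrArg (fun f => lin f x) ht)))
      (by
        intro n x hx
        set y := (LinearEquiv.ofInjective (lin i) hi).symm
          ((lin t).codRestrict (LinearMap.range (lin i))
            (fun x => hex _ (congrArg (fun f => lin f x) ht)) x) with hy
        have hy' : lin i y = lin t x := by
          have := congrArg Subtype.val
            (((LinearEquiv.ofInjective (lin i) hi).symm_apply_eq).1 hy.symm)
          exact this.symm
        have h2 : K.proj n y = y := by
          apply hi
          rw [← proj_lin, hy', M.proj_same n (lin_mem t n hx)]
        change y ∈ K.deg n
        rw [← h2]
        exact K.proj_mem n y))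
    (fun {W} t ht => hom_ext fun x => by
      change lin i ((LinearEquiv.ofInjective (lin i) hi).symm _) = _
      exact congrArg Subtype.val ((LinearEquiv.ofInjective (lin i) hi).apply_symm_apply _))
    (fun {W} t ht m hm => hom_ext fun x => by
      apply hi
      refine (congrArg (fun f => lin f x) hm).trans ?_
      change _ = lin i ((LinearEquiv.ofInjective (lin i) hi).symm _)
      symm
      exact congrArg Subtype.val ((LinearEquiv.ofInjective (lin i) hi).apply_symm_apply _))

theorem exists_hom_preimage {M N : GrMod 𝒜} (p : M ⟶ N) (hp : Function.Surjective (lin p))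
    {n : ℤ} {y : N.carrier} (hy : y ∈ N.deg n) : ∃ x ∈ M.deg n, lin p x = y := by
  obtain ⟨x, rfl⟩ := hp y
  exact ⟨M.proj n x, M.proj_mem n x, by rw [← proj_lin, N.proj_same n hy]⟩

/-- A surjective morphism whose kernel is the image of `f` is a categorical cokernel of `f`. -/
noncomputable def isColimitOfExact {K M N : GrMod 𝒜} (f : K ⟶ M) (p : M ⟶ N) (w : f ≫ p = 0)
    (hp : Function.Surjective (lin p)) (hex : ∀ x, lin p x = 0 → ∃ y, lin f y = x) :
    IsColimit (CokernelCofork.ofπ p w) := by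
  have hker : ∀ {W : GrMod 𝒜} (t : M ⟶ W), f ≫ t = 0 →
      LinearMap.ker (lin p) ≤ LinearMap.ker (lin t) := by
    intro W t ht x hx
    obtain ⟨y, rfl⟩ := hex x hx
    exact congrArg (fun f => lin f y) ht
  refine CokernelCofork.IsColimit.ofπ p w
    (fun {W} t ht => mkHom
      (((LinearMap.ker (lin p)).liftQ (lin t) (hker t ht)).comp
        ((lin p).quotKerEquivOfSurjective hp).symm.toLinearMap) ?_) ?_ ?_
  · intro n y hy
    obtain ⟨x, hx, rfl⟩ := exists_hom_preimage p hp hy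
    have : ((lin p).quotKerEquivOfSurjective hp).symm (lin p x) = Submodule.Quotient.mk x := by
      rw [LinearEquiv.symm_apply_eq]
      rfl
    change (LinearMap.ker (lin p)).liftQ (lin t) (hker t ht)
      (((lin p).quotKerEquivOfSurjective hp).symm (lin p x)) ∈ _
    rw [this]
    exact lin_mem t n hx
  · intro W t ht
    refine hom_ext fun x => ?_
    have : ((lin p).quotKerEquivOfSurjective hp).symm (lin p x) = Submodule.Quotient.mk x := by
      rw [LinearEquiv.symm_apply_eq]
      rfl
    change (LinearMap.ker (lin p)).liftQ (lin t) (hker t ht)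
      (((lin p).quotKerEquivOfSurjective hp).symm (lin p x)) = _
    rw [this]
    rfl
  · intro W t ht m hm
    refine hom_ext fun y => ?_
    obtain ⟨x, rfl⟩ := hp y
    have : ((lin p).quotKerEquivOfSurjective hp).symm (lin p x) = Submodule.Quotient.mk x := by
      rw [LinearEquiv.symm_apply_eq]
      rfl
    change _ = (LinearMap.ker (lin p)).liftQ (lin t) (hker t ht)
      (((lin p).quotKerEquivOfSurjective hp).symm (lin p x))
    rw [this]
    exact congrArg (fun f => lin f x) hm

instance : HasKernels (GrMod 𝒜) :=
  ⟨fun f => HasLimit.mk ⟨_, isLimitOfExact (kerι f) f (kerι_comp f) Subtype.val_injective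
    (fun x hx => ⟨⟨x, hx⟩, rfl⟩)⟩⟩

instance : HasCokernels (GrMod 𝒜) :=
  ⟨fun f => HasColimit.mk ⟨_, isColimitOfExact f (cokerπ f) (comp_cokerπ f)
    (Submodule.mkQ_surjective _) (fun _ hx => (Submodule.Quotient.mk_eq_zero _).1 hx)⟩⟩

theorem injective_of_mono {M N : GrMod 𝒜} (f : M ⟶ N) [Mono f] : Function.Injective (lin f) := by
  rw [injective_iff_map_eq_zero]
  intro x hx
  have h0 : kerι f = 0 := by
    rw [← cancel_mono f, kerι_comp, zero_comp]
  exact congrArg (fun g : ker f ⟶ M => lin g ⟨x, hx⟩) h0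

theorem surjective_of_epi {M N : GrMod 𝒜} (f : M ⟶ N) [Epi f] : Function.Surjective (lin f) := by
  intro y
  have h0 : cokerπ f = 0 := by
    rw [← cancel_epi f, comp_cokerπ, comp_zero]
  exact (Submodule.Quotient.mk_eq_zero _).1 (congrArg (fun g : N ⟶ coker f => lin g y) h0)

theorem epi_of_surjective {M N : GrMod 𝒜} (f : M ⟶ N) (hf : Function.Surjective (lin f)) :
    Epi f :=
  ⟨fun g h hgh => hom_ext fun y => by
    obtain ⟨x, rfl⟩ := hf y
    exact congrArg (fun t => lin t x) hgh⟩

/-- The category of graded modules is abelian. -/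
noncomputable instance : Abelian (GrMod 𝒜) where
  normalMonoOfMono f _ := ⟨
    { Z := coker f
      g := cokerπ f
      w := comp_cokerπ f
      isLimit := isLimitOfExact f (cokerπ f) (comp_cokerπ f) (injective_of_mono f)
        (fun _ hx => (Submodule.Quotient.mk_eq_zero _).1 hx) }⟩
  normalEpiOfEpi f _ := ⟨
    { W := ker f
      g := kerι f
      w := kerι_comp f
      isColimit := isColimitOfExact (kerι f) f (kerι_comp f) (surjective_of_epi f)
        (fun x hx => ⟨⟨x, hx⟩, rfl⟩) }⟩

/-- The degree `j` part of `A_{≥1} M`, generated by the products `a • x` of homogeneous elements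
with `deg a ≥ 1` and `deg a + deg x = j`. -/
def radicalDeg (M : GrMod 𝒜) (j : ℤ) : AddSubgroup (M.deg j) :=
  AddSubgroup.closure {y | ∃ (i : ℕ) (n : ℤ) (a : A) (x : M.carrier),
    0 < i ∧ a ∈ 𝒜 i ∧ x ∈ M.deg n ∧ (i : ℤ) + n = j ∧ (y : M.carrier) = a • x}

/-- A morphism restricted to the components of degree `j`. -/
def degHom {M N : GrMod 𝒜} (f : M ⟶ N) (j : ℤ) : M.deg j →+ N.deg j :=
  ((lin f).toAddMonoidHom.comp (M.deg j).subtype).codRestrict (N.deg j)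
    fun x => lin_mem f j x.2

theorem radicalDeg_le {M N : GrMod 𝒜} (f : M ⟶ N) (j : ℤ) :
    M.radicalDeg j ≤ (N.radicalDeg j).comap (degHom f j) := by
  rw [radicalDeg, AddSubgroup.closure_le]
  rintro y ⟨i, n, a, x, hi, ha, hx, hij, hy⟩
  refine AddSubgroup.subset_closure ⟨i, n, a, lin f x, hi, ha, lin_mem f n hx, hij, ?_⟩
  change lin f y = _
  rw [hy, map_smul]

theorem smul_mem_piece (M : GrMod 𝒜) {i j : ℤ} {a : A} {x : M.carrier}
    (ha : a ∈ gradedPiece 𝒜 i) (hx : x ∈ M.deg j) : a • x ∈ M.deg (i + j) := by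
  cases i with
  | ofNat i => exact M.smul_mem i j a x ha hx
  | negSucc i =>
    rw [show a = 0 from ha, zero_smul]
    exact zero_mem _

section GradedAlgebra

variable [GradedAlgebra 𝒜]

theorem algebraMap_smul_mem (M : GrMod 𝒜) (c : k) (n : ℤ) {x : M.carrier} (hx : x ∈ M.deg n) :
    algebraMap k A c • x ∈ M.deg n := by
  have := M.smul_mem 0 n _ x (SetLike.algebraMap_mem_graded 𝒜 c) hx
  simpa using this

/-- Scalar multiplication by the base field on graded homomorphisms. -/
instance (M N : GrMod 𝒜) : Module k (M ⟶ N) where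
  smul c f := mkHom
    { toFun := fun x => algebraMap k A c • lin f x
      map_add' := fun x y => by simp
      map_smul' := fun a x => by
        simp only [map_smul, RingHom.id_apply, smul_smul]
        rw [Algebra.commutes] }
    (fun n _ hx => N.algebraMap_smul_mem c n (lin_mem f n hx))
  one_smul f := hom_ext fun x => by
    change algebraMap k A 1 • lin f x = _
    simp
  mul_smul c d f := hom_ext fun x => by
    change algebraMap k A (c * d) • lin f x = algebraMap k A c • algebraMap k A d • lin f x
    rw [map_mul, mul_smul]
  smul_zero c := hom_ext fun x => smul_zero (algebraMap k A c)
  smul_add c f g := hom_ext fun x => smul_add (algebraMap k A c) (lin f x) (lin g x)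
  add_smul c d f := hom_ext fun x => by
    change algebraMap k A (c + d) • lin f x = algebraMap k A c • lin f x + algebraMap k A d • lin f x
    rw [map_add, add_smul]
  zero_smul f := hom_ext fun x => by
    change algebraMap k A 0 • lin f x = 0
    rw [map_zero, zero_smul]

/-- The category of graded modules is linear over the base field. -/
instance : Linear k (GrMod 𝒜) where
  smul_comp _ _ _ c f g := hom_ext fun x => by
    change lin g (algebraMap k A c • lin f x) = algebraMap k A c • lin g (lin f x)
    rw [map_smul]
  comp_smul _ _ _ _ _ _ := rfl

end GradedAlgebra

end GrMod

section Piece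

variable (𝒜 : ℕ → Submodule k A)

theorem mem_gradedPiece_add (i : ℕ) (j : ℤ) (a x : A) [GradedAlgebra 𝒜] (ha : a ∈ 𝒜 i)
    (hx : x ∈ gradedPiece 𝒜 j) : a * x ∈ gradedPiece 𝒜 ((i : ℤ) + j) := by
  cases j with
  | ofNat j => exact SetLike.mul_mem_graded (A := 𝒜) ha hx
  | negSucc j =>
    rw [show x = 0 from hx, mul_zero]
    exact zero_mem _

/-- The projection of a graded algebra onto its piece of degree `n`. -/
def gradedPieceProj [GradedAlgebra 𝒜] : ℤ → A →+ A
  | Int.ofNat n => GradedRing.proj 𝒜 n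
  | Int.negSucc _ => 0

variable [GradedAlgebra 𝒜]

theorem gradedPieceProj_same (n : ℤ) {x : A} (hx : x ∈ gradedPiece 𝒜 n) :
    gradedPieceProj 𝒜 n x = x := by
  cases n with
  | ofNat n => exact DirectSum.decompose_of_mem_same 𝒜 hx
  | negSucc n => exact (show x = 0 from hx).symm

theorem gradedPieceProj_ne {m n : ℤ} (h : m ≠ n) {x : A} (hx : x ∈ gradedPiece 𝒜 m) :
    gradedPieceProj 𝒜 n x = 0 := by
  cases m with
  | ofNat m =>
    cases n with
    | ofNat n => exact DirectSum.decompose_of_mem_ne 𝒜 hx (fun h' => h (by rw [h']))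
    | negSucc n => rfl
  | negSucc m => rw [show x = 0 from hx, map_zero]

theorem gradedPiece_induction {p : A → Prop} (x : A) (h0 : p 0)
    (hadd : ∀ x y, p x → p y → p (x + y)) (hhom : ∀ n, ∀ x ∈ gradedPiece 𝒜 n, p x) : p x := by
  induction x using DirectSum.Decomposition.inductionOn 𝒜 with
  | zero => exact h0
  | homogeneous x => exact hhom (Int.ofNat _) x x.2
  | add x y hx hy => exact hadd x y hx hy

end Piece

namespace GrMod

/-- A graded algebra as a graded left module over itself. -/
def regular (𝒜 : ℕ → Submodule k A) [GradedAlgebra 𝒜] : GrMod 𝒜 where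
  carrier := A
  deg n := (gradedPiece 𝒜 n).toAddSubgroup
  isInternal := by
    refine isInternal_of_proj _ (gradedPieceProj 𝒜) (fun n x hx => gradedPieceProj_same 𝒜 n hx)
      (fun m n h x hx => gradedPieceProj_ne 𝒜 h hx) ?_
    intro x
    refine gradedPiece_induction 𝒜 (p := fun x => x ∈ AddSubmonoid.closure _) x (zero_mem _)
      (fun x y hx hy => add_mem hx hy) ?_
    intro n x hx
    exact AddSubmonoid.subset_closure (Set.mem_iUnion.2 ⟨n, hx⟩)
  smul_mem i j a x ha hx := mem_gradedPiece_add 𝒜 i j a x ha hx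

variable {𝒜 : ℕ → Submodule k A} [GradedAlgebra 𝒜]

/-- The projection of a free module with generators of prescribed degrees. -/
noncomputable def freeProj {ι : Type u} (d : ι → ℤ) (n : ℤ) : (ι →₀ A) →+ (ι →₀ A) :=
  Finsupp.liftAddHom fun s => (Finsupp.singleAddHom s).comp (gradedPieceProj 𝒜 (n - d s))

theorem freeProj_apply {ι : Type u} (d : ι → ℤ) (n : ℤ) (f : ι →₀ A) (s : ι) :
    freeProj (𝒜 := 𝒜) d n f s = gradedPieceProj 𝒜 (n - d s) (f s) := by
  classical
  induction f using Finsupp.induction_linear with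
  | zero => simp
  | add f g hf hg => rw [map_add, Finsupp.add_apply, hf, hg, Finsupp.add_apply, map_add]
  | single t a =>
    rw [freeProj, Finsupp.liftAddHom_apply_single]
    change Finsupp.single t (gradedPieceProj 𝒜 (n - d t) a) s = _
    by_cases h : t = s
    · subst h
      simp
    · rw [Finsupp.single_eq_of_ne (Ne.symm h), Finsupp.single_eq_of_ne (Ne.symm h), map_zero]

/-- The graded free module on a family of generators of prescribed degrees. -/
noncomputable def free (𝒜 : ℕ → Submodule k A) [GradedAlgebra 𝒜] {ι : Type u} (d : ι → ℤ) :
    GrMod 𝒜 where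
  carrier := ι →₀ A
  deg n :=
    { carrier := {f | ∀ s, f s ∈ gradedPiece 𝒜 (n - d s)}
      zero_mem' := fun s => zero_mem _
      add_mem' := fun hf hg s => add_mem (hf s) (hg s)
      neg_mem' := fun hf s => neg_mem (hf s) }
  isInternal := by
    refine isInternal_of_proj _ (freeProj (𝒜 := 𝒜) d) ?_ ?_ ?_
    · intro n f hf
      refine Finsupp.ext fun s => ?_
      rw [freeProj_apply]
      exact gradedPieceProj_same 𝒜 _ (hf s)
    · intro m n h f hf
      refine Finsupp.ext fun s => ?_
      rw [freeProj_apply]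
      exact gradedPieceProj_ne 𝒜 (fun h' => h (by omega)) (hf s)
    · intro f
      induction f using Finsupp.induction_linear with
      | zero => exact zero_mem _
      | add f g hf hg => exact add_mem hf hg
      | single t a =>
        refine gradedPiece_induction 𝒜
          (p := fun a => Finsupp.single t a ∈ AddSubmonoid.closure _) a
          (by rw [Finsupp.single_zero]; exact zero_mem _)
          (fun x y hx hy => by rw [Finsupp.single_add]; exact add_mem hx hy) ?_
        intro n a ha
        refine AddSubmonoid.subset_closure (Set.mem_iUnion.2 ⟨n + d t, fun s => ?_⟩)
        classical
        by_cases h : t = s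
        · subst h
          simpa using ha
        · rw [Finsupp.single_eq_of_ne (Ne.symm h)]
          exact zero_mem _
  smul_mem i j a f ha hf s := by
    have := mem_gradedPiece_add 𝒜 i (j - d s) a (f s) ha (hf s)
    rwa [← add_sub_assoc] at this

/-- The morphism from a graded free module determined by homogeneous elements. -/
noncomputable def freeDesc {ι : Type u} (d : ι → ℤ) (M : GrMod 𝒜) (v : ι → M.carrier)
    (hv : ∀ s, v s ∈ M.deg (d s)) : free 𝒜 d ⟶ M :=
  mkHom (M := free 𝒜 d) (Finsupp.linearCombination A v) (by
    intro n (f : ι →₀ A) hf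
    change (∑ s ∈ f.support, f s • v s) ∈ M.deg n
    refine sum_mem fun s _ => ?_
    have := M.smul_mem_piece (hf s) (hv s)
    rwa [sub_add_cancel] at this)

theorem single_mem_free {ι : Type u} (d : ι → ℤ) (t : ι) :
    (Finsupp.single t (1 : A) : ι →₀ A) ∈ (free 𝒜 d).deg (d t) := by
  classical
  intro s
  by_cases h : t = s
  · subst h
    rw [Finsupp.single_eq_same, sub_self]
    exact SetLike.one_mem_graded 𝒜
  · rw [Finsupp.single_eq_of_ne (Ne.symm h)]
    exact zero_mem _

instance {ι : Type u} (d : ι → ℤ) : Projective (free 𝒜 d) where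
  factors {E X} f e _ := by
    choose v hv hv' using fun s => exists_hom_preimage e (surjective_of_epi e)
      (lin_mem f (d s) (single_mem_free d s))
    refine ⟨freeDesc d E v hv, Subtype.ext ?_⟩
    refine Finsupp.lhom_ext' fun s => LinearMap.ext_ring ?_
    change lin e (Finsupp.linearCombination A v (Finsupp.single s 1)) = _
    rw [Finsupp.linearCombination_single, one_smul, hv' s]
    rfl

instance : EnoughProjectives (GrMod 𝒜) where
  presentation M := ⟨
    { p := free 𝒜 (ι := Σ n : ℤ, M.deg n) Sigma.fst
      f := freeDesc Sigma.fst M (fun s => s.2.1) (fun s => s.2.2)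
      epi := epi_of_surjective _ fun x => by
        refine M.induction_hom (p := fun x => ∃ y, lin (freeDesc (𝒜 := 𝒜)
          (ι := Σ n : ℤ, M.deg n) Sigma.fst M (fun s => s.2.1) (fun s => s.2.2)) y = x) x
          ⟨0, map_zero _⟩ ?_ ?_
        · rintro _ _ ⟨x, rfl⟩ ⟨y, rfl⟩
          exact ⟨x + y, map_add _ _ _⟩
        · intro n x hx
          refine ⟨(Finsupp.single ⟨n, ⟨x, hx⟩⟩ 1 : (Σ n : ℤ, M.deg n) →₀ A), ?_⟩
          change Finsupp.linearCombination A _ _ = _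
          rw [Finsupp.linearCombination_single, one_smul] }⟩

instance : HasExt.{u} (GrMod 𝒜) := hasExt_of_enoughProjectives.{u} (GrMod 𝒜)

end GrMod

open GrMod

/-- For a connected graded algebra `A` with `𝕜 = A / A_{≥1}`, the functor sending a graded left
module `M` to the degree `j` part of `𝕜 ⊗_A M = M / A_{≥1} M`. -/
def fieldTensor (𝒜 : ℕ → Submodule k A) (j : ℤ) : GrMod 𝒜 ⥤ AddCommGrpCat.{u} where
  obj M := AddCommGrpCat.of (M.deg j ⧸ M.radicalDeg j)
  map {M N} f := AddCommGrpCat.ofHom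
    (QuotientAddGroup.map (M.radicalDeg j) (N.radicalDeg j) (degHom f j) (radicalDeg_le f j))
  map_id M := by
    ext x
    rfl
  map_comp f g := by
    ext x
    rfl

instance (𝒜 : ℕ → Submodule k A) (j : ℤ) : (fieldTensor 𝒜 j).Additive where
  map_add {M N f g} := by
    ext x
    obtain ⟨x, rfl⟩ := QuotientAddGroup.mk_surjective x
    rfl

/-- The Gelfand-Kirillov dimension: the supremum over finite-dimensional subspaces `V` of
`limsup log (dim (k + V)^n) / log n`. -/
noncomputable def gkDimension (k : Type w) (A : Type u) [Field k] [Ring A] [Algebra k A] : EReal :=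
  ⨆ (V : Submodule k A) (_ : V.FG), Filter.limsup
    (fun n : ℕ => ((Real.log (Module.finrank k ↥((1 ⊔ V) ^ n)) / Real.log n : ℝ) : EReal))
    Filter.atTop

/-- `A` is connected graded: `A_0 = k`. -/
structure IsConnectedGraded (𝒜 : ℕ → Submodule k A) : Prop where
  nontrivial : Nontrivial A
  zero_eq : 𝒜 0 = 1

/-- The opposite algebra with its grading; graded left modules over it are the graded right
modules over `A`. -/
def opGrading (𝒜 : ℕ → Submodule k A) (n : ℕ) : Submodule k Aᵐᵒᵖ :=
  (𝒜 n).map (MulOpposite.opLinearEquiv k : A ≃ₗ[k] Aᵐᵒᵖ).toLinearMap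

section Invariants

variable {𝒜 : ℕ → Submodule k A} [GradedAlgebra 𝒜]

/-- The degree `j` part of `Tor_i^A(𝕜, M)`. -/
noncomputable def grTor (M : GrMod 𝒜) (i : ℕ) (j : ℤ) : AddCommGrpCat.{u} :=
  ((fieldTensor 𝒜 j).leftDerived i).obj M

/-- `t_i(M)`, the largest degree in which `Tor_i^A(𝕜, M)` is nonzero (`⊥ = -∞` if there is none,
`⊤ = ∞` if these degrees are unbounded). -/
noncomputable def torDeg (M : GrMod 𝒜) (i : ℕ) : EReal :=
  ⨆ (j : ℤ) (_ : Nontrivial (grTor M i j)), ((j : ℝ) : EReal)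

/-- The Tor-regularity of `M`: the supremum of `j - i` over all `i, j` with
`Tor_i^A(𝕜, M)_j ≠ 0`. -/
noncomputable def torReg (M : GrMod 𝒜) : EReal :=
  ⨆ (i : ℕ) (j : ℤ) (_ : Nontrivial (grTor M i j)), (((j : ℝ) - (i : ℝ) : ℝ) : EReal)

instance : HasFiniteBiproducts (GrMod 𝒜) := HasFiniteBiproducts.of_hasFiniteProducts

/-- `M` is linear: it has a (necessarily minimal) free resolution
`⋯ → A(-i)^{β_i} → ⋯ → A(-1)^{β_1} → A^{β_0} → M → 0`. -/
def HasLinearResolution (M : GrMod 𝒜) : Prop :=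
  ∃ (P : ProjectiveResolution M) (β : ℕ → ℕ), ∀ i : ℕ,
    Nonempty (P.complex.X i ≅ ⨁ fun _ : Fin (β i) => (regular 𝒜).shift (-(i : ℤ)))

variable (𝒜)

theorem regular_proj (n : ℤ) (x : A) : (regular 𝒜).proj n x = gradedPieceProj 𝒜 n x := by
  refine gradedPiece_induction 𝒜 (p := fun x => (regular 𝒜).proj n x = gradedPieceProj 𝒜 n x) x
    ((map_zero _).trans (map_zero _).symm)
    (fun x y hx hy => by rw [map_add, ← hx, ← hy]; exact map_add _ _ _) ?_
  intro m x hx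
  by_cases h : m = n
  · subst h
    rw [gradedPieceProj_same 𝒜 m hx]
    exact (regular 𝒜).proj_same m hx
  · rw [gradedPieceProj_ne 𝒜 h hx]
    exact (regular 𝒜).proj_ne h hx

theorem proj_zero_gradedPieceProj (n : ℤ) (x : A) (hx : GradedRing.proj 𝒜 0 x = 0) :
    GradedRing.proj 𝒜 0 (gradedPieceProj 𝒜 n x) = 0 := by
  cases n with
  | ofNat n =>
    by_cases h : n = 0
    · subst h
      change GradedRing.proj 𝒜 0 (GradedRing.proj 𝒜 0 x) = 0
      rw [hx, map_zero]
    · exact DirectSum.decompose_of_mem_ne 𝒜 (SetLike.coe_mem _) h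
  | negSucc n => exact map_zero _

/-- The trivial graded left module `𝕜 = A / A_{≥1}`. -/
def trivialModule : GrMod 𝒜 :=
  (regular 𝒜).quot (RingHom.ker (GradedRing.projZeroRingHom 𝒜)) (by
    intro n x hx
    exact (congrArg (GradedRing.proj 𝒜 0) (regular_proj 𝒜 n x)).trans
      (proj_zero_gradedPieceProj 𝒜 n x hx))

/-- `A` is Koszul: the trivial module has a linear resolution. -/
def IsKoszul : Prop := HasLinearResolution (trivialModule 𝒜)

/-- The global dimension: the supremum of the projective dimensions of graded left modules. -/
noncomputable def gradedGlobalDimension : WithBot ℕ∞ :=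
  ⨆ M : GrMod 𝒜, projectiveDimension M

noncomputable instance : GradedAlgebra (opGrading 𝒜) where
  one_mem := ⟨1, SetLike.one_mem_graded 𝒜, rfl⟩
  mul_mem := by
    rintro i j _ _ ⟨a, ha, rfl⟩ ⟨b, hb, rfl⟩
    exact ⟨b * a, by rw [add_comm]; exact SetLike.mul_mem_graded hb ha, rfl⟩
  toDecomposition := DirectSum.IsInternal.chooseDecomposition _ (by
    refine isInternal_of_proj _ (fun n => (MulOpposite.opAddEquiv.toAddMonoidHom.comp
      (GradedRing.proj 𝒜 n)).comp MulOpposite.opAddEquiv.symm.toAddMonoidHom) ?_ ?_ ?_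
    · rintro n _ ⟨x, hx, rfl⟩
      exact congrArg MulOpposite.op (DirectSum.decompose_of_mem_same 𝒜 hx)
    · rintro m n h _ ⟨x, hx, rfl⟩
      exact congrArg MulOpposite.op (DirectSum.decompose_of_mem_ne 𝒜 hx h)
    · intro x
      induction x using MulOpposite.rec' with | _ x
      induction x using DirectSum.Decomposition.inductionOn 𝒜 with
      | zero => exact zero_mem _
      | homogeneous x =>
        exact AddSubmonoid.subset_closure (Set.mem_iUnion.2 ⟨_, x.1, x.2, rfl⟩)
      | add x y hx hy => exact add_mem hx hy)

/-- The degree `j` part of `Ext^i_A(𝕜, A)`, i.e. `Ext^i` in the category of graded left modules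
from `𝕜` to `A(j)`. -/
abbrev extField (i : ℕ) (j : ℤ) : Type u :=
  Abelian.Ext (trivialModule 𝒜) ((regular 𝒜).shift j) i

/-- The one-sided part of the Artin-Schelter Gorenstein condition of type `(d, l)`, for left
modules: `A` has injective dimension `d`, `Ext^i(𝕜, A) = 0` for `i ≠ d`, and `Ext^d(𝕜, A) ≅ 𝕜(l)`,
which is one-dimensional in degree `-l` and zero in all other degrees. -/
structure IsLeftASGorenstein (d : ℕ) (l : ℤ) : Prop where
  injectiveDimension_eq : injectiveDimension (regular 𝒜) = d
  ext_eq_zero : ∀ i : ℕ, i ≠ d → ∀ j : ℤ, Subsingleton (extField 𝒜 i j)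
  rank_ext : ∀ j : ℤ, Module.rank k (extField 𝒜 d j) = if j + l = 0 then 1 else 0

/-- Artin-Schelter Gorenstein of type `(d, l)`: the condition holds for left and for right
modules. -/
def IsASGorenstein (d : ℕ) (l : ℤ) : Prop :=
  IsLeftASGorenstein 𝒜 d l ∧ IsLeftASGorenstein (opGrading 𝒜) d l

/-- Artin-Schelter regular: connected graded, Artin-Schelter Gorenstein of some type, of finite
global dimension and of finite Gelfand-Kirillov dimension. -/
structure IsASRegular : Prop where
  connected : IsConnectedGraded 𝒜
  gorenstein : ∃ (d : ℕ) (l : ℤ), IsASGorenstein 𝒜 d l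
  gradedGlobalDimension_lt_top : gradedGlobalDimension 𝒜 < ⊤
  gkDimension_lt_top : gkDimension k A < ⊤

end Invariants

end Graded

section FiniteMap

variable {k : Type w} {T A : Type u} [Field k] [Ring T] [Algebra k T] [Ring A] [Algebra k A]

/-- A ring that is both left and right noetherian. -/
def IsTwoSidedNoetherian (R : Type u) [Ring R] : Prop :=
  IsNoetherianRing R ∧ IsNoetherianRing Rᵐᵒᵖ

/-- `φ : T → A` is finite: `A` is finitely generated as a left and as a right `T`-module. -/
def IsFiniteMap (φ : T →ₐ[k] A) : Prop :=
  (letI : Module T A := Module.compHom A φ.toRingHom; Module.Finite T A) ∧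
  (letI : Module Tᵐᵒᵖ A := Module.compHom A (RingHom.op φ.toRingHom); Module.Finite Tᵐᵒᵖ A)

/-- A graded left `A`-module as a graded left `T`-module along a graded algebra map `T → A`. -/
def GrMod.restrict {𝒯 : ℕ → Submodule k T} {𝒜 : ℕ → Submodule k A} (φ : T →ₐ[k] A)
    (hφ : ∀ (n : ℕ), ∀ t ∈ 𝒯 n, φ t ∈ 𝒜 n) (M : GrMod 𝒜) : GrMod 𝒯 where
  carrier := M.carrier
  module := Module.compHom M.carrier φ.toRingHom
  deg := M.deg
  isInternal := M.isInternal
  smul_mem i j t x ht hx := M.smul_mem i j (φ t) x (hφ i t ht) hx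

end FiniteMap

/-!
Everything rests on dimension shifting for `Tor(𝕜, -)` in a fixed internal degree. For a short exact
sequence `0 ⟶ K ⟶ P ⟶ M ⟶ 0` with `P` projective, `Tor_{n+2}(M)` vanishes exactly when
`Tor_{n+1}(K)` does, and `Tor_1(M)` vanishes exactly when `K / A_{≥1} K ⟶ P / A_{≥1} P` is injective.
Only vanishing statements are needed, so in place of the long exact sequence of Tor there are the
three implications `IsShortExact.torVanishes_left`, `torVanishes_middle` and `torVanishes_right`.

Let `M` be a finitely generated graded `A`-module, with a minimal cover `0 ⟶ K ⟶ F ⟶ M ⟶ 0` by a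
finite graded free module (`exists_minimal_cover`). Its generators lie in degrees `e` with
`Tor_0^A(M)_e ≠ 0`, and `Tor_i^A(K) = Tor_{i+1}^A(M)` for all `i`. Restricting the sequence to `T`,
induction on the homological degree gives two comparisons.

* `exists_tor_of_tor_restrict`: if `Tor_s^T(M)_j ≠ 0` then `Tor_p^A(M)_e ≠ 0` and
  `Tor_q^T(A)_{j-e} ≠ 0` for some `p + q = s` and some `e`. This is what the change of rings spectral
  sequence says about vanishing, and the inequality of Tor-regularities follows at once.
* `exists_tor_restrict_of_tor`: if `A` is linear over `T` and `Tor_s^A(M)_j ≠ 0`, then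
  `Tor_i^T(M)_e ≠ 0` for some `i ≤ s` and some `e` with `j - s ≤ e - i`.

For linear `A` the first comparison has the same shape as the second, with `T` and `A` exchanged.
Taking `M = 𝕜`, which restricts to the trivial module of `T`, all statements about `t_i(𝕜)` and the
Tor-regularity of `𝕜` follow. Finally, a connected graded noetherian algebra is Koszul exactly when
`Tor_i(𝕜, 𝕜)_j ≠ 0` forces `j ≤ i` (`isKoszul_iff`): the minimal covers of the successive syzygies of
`𝕜` are then generated in a single degree and splice to a linear resolution.
-/

/-! ### Resolutions spliced from short exact sequences -/

section Syzygies

universe v' u'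

variable {C : Type u'} [Category.{v'} C] [Abelian C]

/-- A sequence of short exact sequences `0 ⟶ Ω (n + 1) ⟶ P n ⟶ Ω n ⟶ 0` with projective middle
terms. -/
structure SyzygySequence (C : Type u') [Category.{v'} C] [Abelian C] where
  /-- the syzygies -/
  Ω : ℕ → C
  /-- the projective objects covering them -/
  P : ℕ → C
  /-- the inclusions -/
  ι : ∀ n, Ω (n + 1) ⟶ P n
  /-- the covers -/
  π : ∀ n, P n ⟶ Ω n
  zero : ∀ n, ι n ≫ π n = 0
  shortExact : ∀ n, (ShortComplex.mk (ι n) (π n) (zero n)).ShortExact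
  projective : ∀ n, Projective (P n)

namespace SyzygySequence

variable (S : SyzygySequence C)

instance (n : ℕ) : Mono (S.ι n) := (S.shortExact n).mono_f

instance (n : ℕ) : Epi (S.π n) := (S.shortExact n).epi_g

theorem comp_ι_zero (n : ℕ) : (S.π (n + 2) ≫ S.ι (n + 1)) ≫ S.π (n + 1) ≫ S.ι n = 0 := by
  rw [Category.assoc, reassoc_of% S.zero (n + 1), zero_comp, comp_zero]

/-- The complex `⋯ ⟶ P 2 ⟶ P 1 ⟶ P 0`. -/
noncomputable def complex : ChainComplex C ℕ :=
  ChainComplex.of S.P (fun n => S.π (n + 1) ≫ S.ι n) S.comp_ι_zero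

theorem complex_d (n : ℕ) : S.complex.d (n + 1) n = S.π (n + 1) ≫ S.ι n :=
  ChainComplex.of_d S.P (fun n => S.π (n + 1) ≫ S.ι n) n

theorem exact_comp_ι (n : ℕ) : (ShortComplex.mk (S.π (n + 1) ≫ S.ι n) (S.π n)
    (by rw [Category.assoc, S.zero, comp_zero])).Exact := by
  let α : ShortComplex.mk (S.π (n + 1) ≫ S.ι n) (S.π n)
      (by rw [Category.assoc, S.zero, comp_zero]) ⟶ ShortComplex.mk (S.ι n) (S.π n) (S.zero n) :=
    { τ₁ := S.π (n + 1)
      τ₂ := 𝟙 _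
      τ₃ := 𝟙 _ }
  have : Epi α.τ₁ := inferInstanceAs (Epi (S.π (n + 1)))
  have : IsIso α.τ₂ := inferInstanceAs (IsIso (𝟙 _))
  have : Mono α.τ₃ := inferInstanceAs (Mono (𝟙 _))
  rw [ShortComplex.exact_iff_of_epi_of_isIso_of_mono α]
  exact (S.shortExact n).exact

theorem exact_comp_comp (n : ℕ) : (ShortComplex.mk (S.π (n + 2) ≫ S.ι (n + 1))
    (S.π (n + 1) ≫ S.ι n) (S.comp_ι_zero n)).Exact := by
  let α : ShortComplex.mk (S.π (n + 2) ≫ S.ι (n + 1)) (S.π (n + 1))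
      (by rw [Category.assoc, S.zero, comp_zero]) ⟶
      ShortComplex.mk (S.π (n + 2) ≫ S.ι (n + 1)) (S.π (n + 1) ≫ S.ι n) (S.comp_ι_zero n) :=
    { τ₁ := 𝟙 _
      τ₂ := 𝟙 _
      τ₃ := S.ι n }
  have : Epi α.τ₁ := inferInstanceAs (Epi (𝟙 _))
  have : IsIso α.τ₂ := inferInstanceAs (IsIso (𝟙 _))
  have : Mono α.τ₃ := inferInstanceAs (Mono (S.ι n))
  rw [← ShortComplex.exact_iff_of_epi_of_isIso_of_mono α]
  exact S.exact_comp_ι (n + 1)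

theorem complex_exactAt_succ (n : ℕ) : S.complex.ExactAt (n + 1) := by
  rw [HomologicalComplex.exactAt_iff' _ (n + 2) (n + 1) n (by simp) (by simp)]
  refine (ShortComplex.exact_iff_of_iso ?_).2 (S.exact_comp_comp n)
  exact ShortComplex.isoMk (Iso.refl _) (Iso.refl _) (Iso.refl _)
    ((Category.id_comp _).trans ((S.complex_d (n + 1)).symm.trans (Category.comp_id _).symm))
    ((Category.id_comp _).trans ((S.complex_d n).symm.trans (Category.comp_id _).symm))

theorem complex_d_comp_π : S.complex.d 1 0 ≫ S.π 0 = 0 :=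
  (congrArg (fun f : S.P 1 ⟶ S.P 0 => f ≫ S.π 0) (S.complex_d 0)).trans (by
    rw [Category.assoc, S.zero, comp_zero]
    rfl)

/-- Splicing the short exact sequences gives a projective resolution of `Ω 0`. -/
noncomputable def resolution : ProjectiveResolution (S.Ω 0) where
  complex := S.complex
  projective := S.projective
  π := (ChainComplex.toSingle₀Equiv _ _).symm ⟨S.π 0, S.complex_d_comp_π⟩
  quasiIso := ⟨fun n => by
    cases n
    · rw [ChainComplex.quasiIsoAt₀_iff, ShortComplex.quasiIso_iff_of_zeros']
      · refine (ShortComplex.exact_and_epi_g_iff_of_iso ?_).2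
          ⟨S.exact_comp_ι 0, inferInstanceAs (Epi (S.π 0))⟩
        exact ShortComplex.isoMk (Iso.refl _) (Iso.refl _) (Iso.refl _)
          ((Category.id_comp _).trans ((S.complex_d 0).symm.trans (Category.comp_id _).symm))
          ((Category.id_comp _).trans ((ChainComplex.toSingle₀Equiv_symm_apply_f_zero
            (C := S.complex) (X := S.Ω 0) (S.π 0) S.complex_d_comp_π).symm.trans
            (Category.comp_id _).symm))
      all_goals rfl
    · rw [quasiIsoAt_iff_exactAt']
      · exact S.complex_exactAt_succ _
      · exact ChainComplex.exactAt_succ_single_obj _ _⟩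

/-- The syzygies obtained from the chosen projective covers. -/
noncomputable def standard [EnoughProjectives C] (M : C) : SyzygySequence C where
  Ω n := Nat.rec M (fun _ X => kernel (Projective.π X)) n
  P n := Projective.over (Nat.rec M (fun _ X => kernel (Projective.π X)) n)
  ι _ := kernel.ι _
  π _ := Projective.π _
  zero _ := kernel.condition _
  shortExact _ :=
    { exact := ShortComplex.exact_kernel _
      mono_f := inferInstanceAs (Mono (kernel.ι _))
      epi_g := inferInstanceAs (Epi (Projective.π _)) }
  projective _ := Projective.projective_over _

/-- Extending a sequence of syzygies by one step. -/
def cons {F M : C} (f : S.Ω 0 ⟶ F) (g : F ⟶ M) (hfg : f ≫ g = 0)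
    (h : (ShortComplex.mk f g hfg).ShortExact) (hF : Projective F) : SyzygySequence C where
  Ω := Nat.rec M (fun n _ => S.Ω n)
  P := Nat.rec F (fun n _ => S.P n)
  ι := Nat.rec f (fun n _ => S.ι n)
  π := Nat.rec g (fun n _ => S.π n)
  zero := Nat.rec hfg (fun n _ => S.zero n)
  shortExact := Nat.rec h (fun n _ => S.shortExact n)
  projective := Nat.rec hF (fun n _ => S.projective n)

/-- A right exact functor has vanishing left derived functor in degree `n + 1` exactly when it
keeps the inclusion of the `(n + 1)`-st syzygy injective. -/
theorem subsingleton_leftDerived_succ_iff [EnoughProjectives C] (G : C ⥤ AddCommGrpCat.{v'})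
    [G.Additive] [PreservesFiniteColimits G] (n : ℕ) :
    Subsingleton ((G.leftDerived (n + 1)).obj (S.Ω 0)) ↔
      Function.Injective (G.map (S.ι n)) := by
  have e := S.resolution.isoLeftDerivedObj G (n + 1)
  rw [← AddCommGrpCat.isZero_iff_subsingleton, e.isZero_iff]
  erw [← HomologicalComplex.exactAt_iff_isZero_homology]
  rw [HomologicalComplex.exactAt_iff' _ (n + 2) (n + 1) n (by simp) (by simp)]
  let T : ShortComplex AddCommGrpCat :=
    (ShortComplex.mk (S.π (n + 2) ≫ S.ι (n + 1)) (S.π (n + 1) ≫ S.ι n) (S.comp_ι_zero n)).map G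
  have iso : ((G.mapHomologicalComplex (ComplexShape.down ℕ)).obj S.resolution.complex).sc'
      (n + 2) (n + 1) n ≅ T :=
    ShortComplex.isoMk (Iso.refl _) (Iso.refl _) (Iso.refl _)
      ((Category.id_comp _).trans ((congrArg G.map (S.complex_d (n + 1))).symm.trans
        (Category.comp_id _).symm))
      ((Category.id_comp _).trans ((congrArg G.map (S.complex_d n)).symm.trans
        (Category.comp_id _).symm))
  rw [ShortComplex.exact_iff_of_iso iso, ShortComplex.ab_exact_iff]
  have h1 := ((G.preservesFiniteColimits_iff_forall_exact_map_and_epi.1 inferInstance) _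
    (S.shortExact (n + 1))).1
  rw [ShortComplex.ab_exact_iff] at h1
  have h2 : ∀ m, Function.Surjective (G.map (S.π m)) := fun m =>
    (AddCommGrpCat.epi_iff_surjective _).1 inferInstance
  have hcomp : ∀ {X Y Z : C} (f : X ⟶ Y) (g : Y ⟶ Z) (x : G.obj X),
      G.map (f ≫ g) x = G.map g (G.map f x) := by
    intro X Y Z f g x
    rw [G.map_comp, ConcreteCategory.comp_apply]
  have h3 : ∀ x, G.map (S.π (n + 1)) (G.map (S.ι (n + 1)) x) = 0 := by
    intro x
    rw [← hcomp, S.zero, G.map_zero]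
    rfl
  constructor
  · intro H
    rw [injective_iff_map_eq_zero]
    intro x hx
    obtain ⟨y, rfl⟩ := h2 _ x
    obtain ⟨z, hz⟩ := H y ((hcomp _ _ y).trans hx)
    rw [← (hcomp _ _ z).symm.trans hz, h3]
  · intro H y hy
    obtain ⟨z, hz⟩ := h1 y (H (((hcomp _ _ y).symm.trans hy).trans (map_zero _).symm))
    obtain ⟨t, rfl⟩ := h2 _ z
    exact ⟨t, (hcomp _ _ t).trans hz⟩

end SyzygySequence

section DimensionShift

variable [EnoughProjectives C] (G : C ⥤ AddCommGrpCat.{v'}) [G.Additive]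
  [PreservesFiniteColimits G] {K F M : C} (f : K ⟶ F) (g : F ⟶ M) (hfg : f ≫ g = 0)
  (h : (ShortComplex.mk f g hfg).ShortExact) (hF : Projective F)

include h hF

theorem subsingleton_leftDerived_one_iff :
    Subsingleton ((G.leftDerived 1).obj M) ↔ Function.Injective (G.map f) :=
  ((SyzygySequence.standard K).cons f g hfg h hF).subsingleton_leftDerived_succ_iff G 0

theorem subsingleton_leftDerived_add_two_iff (n : ℕ) :
    Subsingleton ((G.leftDerived (n + 2)).obj M) ↔
      Subsingleton ((G.leftDerived (n + 1)).obj K) :=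
  (((SyzygySequence.standard K).cons f g hfg h hF).subsingleton_leftDerived_succ_iff G
    (n + 1)).trans ((SyzygySequence.standard K).subsingleton_leftDerived_succ_iff G n).symm

end DimensionShift

end Syzygies

/-! ### Short exact sequences of graded modules and vanishing of Tor -/

namespace GrMod

section ShortExact

variable {k : Type w} {A : Type u} [Field k] [Ring A] [Algebra k A] {𝒜 : ℕ → Submodule k A}

/-- Short exactness of `0 ⟶ K ⟶ F ⟶ M ⟶ 0`, stated for elements. -/
structure IsShortExact {K F M : GrMod 𝒜} (f : K ⟶ F) (g : F ⟶ M) : Prop where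
  injective : Function.Injective (lin f)
  surjective : Function.Surjective (lin g)
  exact : ∀ y, lin g y = 0 ↔ ∃ x, lin f x = y

namespace IsShortExact

variable {K F M : GrMod 𝒜} {f : K ⟶ F} {g : F ⟶ M}

theorem lin_lin (h : IsShortExact f g) (x : K.carrier) : lin g (lin f x) = 0 :=
  (h.exact _).2 ⟨x, rfl⟩

theorem comp_eq_zero (h : IsShortExact f g) : f ≫ g = 0 := hom_ext h.lin_lin

theorem exists_mem_deg (h : IsShortExact f g) {j : ℤ} {y : F.carrier} (hy : y ∈ F.deg j)
    (hy0 : lin g y = 0) : ∃ x ∈ K.deg j, lin f x = y := by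
  obtain ⟨x, rfl⟩ := (h.exact y).1 hy0
  exact ⟨K.proj j x, K.proj_mem j x, by rw [← proj_lin, F.proj_same j hy]⟩

end IsShortExact

theorem isShortExact_iff {K F M : GrMod 𝒜} {f : K ⟶ F} {g : F ⟶ M} (w : f ≫ g = 0) :
    (ShortComplex.mk f g w).ShortExact ↔ IsShortExact f g := by
  constructor
  · intro h
    have : Mono f := h.mono_f
    have : Epi g := h.epi_g
    refine ⟨injective_of_mono f, surjective_of_epi g, fun y => ⟨fun hy => ?_, ?_⟩⟩
    · let l := h.fIsKernel.lift (KernelFork.ofι (kerι g) (kerι_comp g))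
      have hl : l ≫ f = kerι g := h.fIsKernel.fac _ WalkingParallelPair.zero
      exact ⟨lin l ⟨y, hy⟩, congrArg (fun t : ker g ⟶ F => lin t ⟨y, hy⟩) hl⟩
    · rintro ⟨x, rfl⟩
      exact congrArg (fun t => lin t x) w
  · intro h
    have hf : Mono f := ⟨fun s t hst => hom_ext fun x =>
      h.injective (congrArg (fun r => lin r x) hst)⟩
    have : Epi g := epi_of_surjective g h.surjective
    exact
      { exact := ShortComplex.exact_of_f_is_kernel _
          (isLimitOfExact f g w h.injective fun x hx => (h.exact x).1 hx)
        mono_f := hf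
        epi_g := inferInstance }

theorem IsShortExact.shortExact {K F M : GrMod 𝒜} {f : K ⟶ F} {g : F ⟶ M}
    (h : IsShortExact f g) : (ShortComplex.mk f g h.comp_eq_zero).ShortExact :=
  (isShortExact_iff _).2 h

theorem isShortExact_kerι {F M : GrMod 𝒜} (g : F ⟶ M) (hg : Function.Surjective (lin g)) :
    IsShortExact (kerι g) g :=
  ⟨Subtype.val_injective, hg, fun y => ⟨fun hy => ⟨⟨y, hy⟩, rfl⟩, fun ⟨x, hx⟩ => hx ▸ x.2⟩⟩

/-- The degree `j` part of `A_{≥1} M`. Unlike `radicalDeg`, it is a subgroup of `M` rather than of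
`M_j`, so that its elements can be compared without coercions. -/
def radical (M : GrMod 𝒜) (j : ℤ) : AddSubgroup M.carrier :=
  AddSubgroup.closure {y | ∃ (i : ℕ) (n : ℤ) (a : A) (x : M.carrier),
    0 < i ∧ a ∈ 𝒜 i ∧ x ∈ M.deg n ∧ (i : ℤ) + n = j ∧ y = a • x}

theorem radical_le_deg (M : GrMod 𝒜) (j : ℤ) : M.radical j ≤ M.deg j := by
  rw [radical, AddSubgroup.closure_le]
  rintro _ ⟨i, n, a, x, -, ha, hx, rfl, rfl⟩
  exact M.smul_mem i n a x ha hx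

theorem smul_mem_radical (M : GrMod 𝒜) {i : ℕ} {n j : ℤ} {a : A} {x : M.carrier} (hi : 0 < i)
    (ha : a ∈ 𝒜 i) (hx : x ∈ M.deg n) (hj : (i : ℤ) + n = j) : a • x ∈ M.radical j :=
  AddSubgroup.subset_closure ⟨i, n, a, x, hi, ha, hx, hj, rfl⟩

theorem mem_radicalDeg_iff (M : GrMod 𝒜) {j : ℤ} (y : M.deg j) :
    y ∈ M.radicalDeg j ↔ (y : M.carrier) ∈ M.radical j := by
  have : M.radical j = (M.radicalDeg j).map (M.deg j).subtype := by
    rw [radicalDeg, AddMonoidHom.map_closure]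
    refine congrArg AddSubgroup.closure (Set.ext fun z => ⟨?_, ?_⟩)
    · rintro ⟨i, n, a, x, hi, ha, hx, hj, rfl⟩
      exact ⟨⟨a • x, hj ▸ M.smul_mem i n a x ha hx⟩, ⟨i, n, a, x, hi, ha, hx, hj, rfl⟩, rfl⟩
    · rintro ⟨z, ⟨i, n, a, x, hi, ha, hx, hj, hz⟩, rfl⟩
      exact ⟨i, n, a, x, hi, ha, hx, hj, hz⟩
  rw [this]
  constructor
  · exact fun hy => ⟨y, hy, rfl⟩
  · rintro ⟨z, hz, hzy⟩
    rwa [← Subtype.ext (hzy : (z : M.carrier) = y)]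

theorem lin_mem_radical {M N : GrMod 𝒜} (f : M ⟶ N) {j : ℤ} {x : M.carrier}
    (hx : x ∈ M.radical j) : lin f x ∈ N.radical j := by
  have : M.radical j ≤ (N.radical j).comap (lin f).toAddMonoidHom := by
    rw [radical, AddSubgroup.closure_le]
    rintro _ ⟨i, n, a, x, hi, ha, hx, hj, rfl⟩
    change lin f (a • x) ∈ N.radical j
    rw [map_smul]
    exact N.smul_mem_radical hi ha (lin_mem f n hx) hj
  exact this hx

theorem exists_mem_radical {M N : GrMod 𝒜} (g : M ⟶ N) (hg : Function.Surjective (lin g)) {j : ℤ}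
    {y : N.carrier} (hy : y ∈ N.radical j) : ∃ x ∈ M.radical j, lin g x = y := by
  have : N.radical j ≤ (M.radical j).map (lin g).toAddMonoidHom := by
    rw [radical, AddSubgroup.closure_le]
    rintro _ ⟨i, n, a, y, hi, ha, hy, hj, rfl⟩
    obtain ⟨x, hx, rfl⟩ := exists_hom_preimage g hg hy
    exact ⟨a • x, M.smul_mem_radical hi ha hx hj, map_smul (lin g) a x⟩
  exact this hy

/-- Right exactness of `𝕜 ⊗_A -` in the middle term. -/
theorem IsShortExact.exists_sub_mem_radical {K F M : GrMod 𝒜} {f : K ⟶ F} {g : F ⟶ M}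
    (h : IsShortExact f g) {j : ℤ} {y : F.carrier} (hy : y ∈ F.deg j)
    (hgy : lin g y ∈ M.radical j) : ∃ x ∈ K.deg j, y - lin f x ∈ F.radical j := by
  obtain ⟨z, hz, hzy⟩ := exists_mem_radical g h.surjective hgy
  obtain ⟨x, hx, hxy⟩ := h.exists_mem_deg (sub_mem hy (F.radical_le_deg j hz))
    (by rw [map_sub, hzy, sub_self])
  exact ⟨x, hx, by rwa [hxy, sub_sub_cancel]⟩

theorem subsingleton_fieldTensor_iff (M : GrMod 𝒜) (j : ℤ) :
    Subsingleton ((fieldTensor 𝒜 j).obj M) ↔ M.deg j ≤ M.radical j := by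
  change Subsingleton (M.deg j ⧸ M.radicalDeg j) ↔ _
  rw [QuotientAddGroup.subsingleton_iff, AddSubgroup.eq_top_iff']
  simp only [mem_radicalDeg_iff]
  exact ⟨fun h x hx => h ⟨x, hx⟩, fun h x => h x.2⟩

theorem injective_fieldTensor_map_iff {K F : GrMod 𝒜} (f : K ⟶ F) (j : ℤ) :
    Function.Injective ((fieldTensor 𝒜 j).map f) ↔
      ∀ x ∈ K.deg j, lin f x ∈ F.radical j → x ∈ K.radical j := by
  rw [injective_iff_map_eq_zero]
  constructor
  · intro h x hx hfx
    have := h (QuotientAddGroup.mk ⟨x, hx⟩)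
      ((QuotientAddGroup.eq_zero_iff _).2 ((F.mem_radicalDeg_iff _).2 hfx))
    exact (K.mem_radicalDeg_iff _).1 ((QuotientAddGroup.eq_zero_iff _).1 this)
  · intro h x hx
    obtain ⟨x, rfl⟩ := QuotientAddGroup.mk_surjective x
    exact (QuotientAddGroup.eq_zero_iff _).2 ((K.mem_radicalDeg_iff _).2
      (h x.1 x.2 ((F.mem_radicalDeg_iff _).1 ((QuotientAddGroup.eq_zero_iff _).1 hx))))

end ShortExact

section Tor

variable {k : Type w} {A : Type u} [Field k] [Ring A] [Algebra k A] {𝒜 : ℕ → Submodule k A}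
  [GradedAlgebra 𝒜]

instance (j : ℤ) : PreservesFiniteColimits (fieldTensor 𝒜 j) := by
  rw [Functor.preservesFiniteColimits_iff_forall_exact_map_and_epi]
  intro S hS
  have h := (isShortExact_iff S.zero).1 hS
  constructor
  · rw [ShortComplex.ab_exact_iff]
    intro y hy
    obtain ⟨y, rfl⟩ := QuotientAddGroup.mk_surjective y
    have hy' := (S.X₃.mem_radicalDeg_iff _).1 ((QuotientAddGroup.eq_zero_iff _).1 hy)
    obtain ⟨x, hx, hxy⟩ := h.exists_sub_mem_radical y.2 hy'
    refine ⟨QuotientAddGroup.mk ⟨x, hx⟩, QuotientAddGroup.eq.2 ?_⟩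
    rw [mem_radicalDeg_iff]
    change -lin S.f x + y.1 ∈ _
    rwa [neg_add_eq_sub]
  · rw [AddCommGrpCat.epi_iff_surjective]
    intro y
    obtain ⟨y, rfl⟩ := QuotientAddGroup.mk_surjective y
    obtain ⟨x, hx, hxy⟩ := exists_hom_preimage S.g h.surjective y.2
    exact ⟨QuotientAddGroup.mk ⟨x, hx⟩, congrArg QuotientAddGroup.mk (Subtype.ext hxy)⟩

/-- `Tor_i^A(𝕜, M)_j = 0`. -/
abbrev TorVanishes (M : GrMod 𝒜) (i : ℕ) (j : ℤ) : Prop := Subsingleton (grTor M i j)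

theorem torVanishes_zero_iff (M : GrMod 𝒜) (j : ℤ) :
    TorVanishes M 0 j ↔ M.deg j ≤ M.radical j := by
  rw [TorVanishes, ← subsingleton_fieldTensor_iff, ← AddCommGrpCat.isZero_iff_subsingleton,
    ← AddCommGrpCat.isZero_iff_subsingleton]
  exact ((fieldTensor 𝒜 j).leftDerivedZeroIsoSelf.app M).isZero_iff

section Shift

variable {K F M : GrMod 𝒜} {f : K ⟶ F} {g : F ⟶ M}

theorem torVanishes_one_iff (h : IsShortExact f g) (hF : Projective F) (j : ℤ) :
    TorVanishes M 1 j ↔ ∀ x ∈ K.deg j, lin f x ∈ F.radical j → x ∈ K.radical j :=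
  (subsingleton_leftDerived_one_iff (fieldTensor 𝒜 j) f g h.comp_eq_zero h.shortExact hF).trans
    (injective_fieldTensor_map_iff f j)

theorem torVanishes_add_two_iff (h : IsShortExact f g) (hF : Projective F) (n : ℕ) (j : ℤ) :
    TorVanishes M (n + 2) j ↔ TorVanishes K (n + 1) j :=
  subsingleton_leftDerived_add_two_iff (fieldTensor 𝒜 j) f g h.comp_eq_zero h.shortExact hF n

end Shift

theorem torVanishes_of_projective (P : GrMod 𝒜) (hP : Projective P) (n : ℕ) (j : ℤ) :
    TorVanishes P (n + 1) j :=
  AddCommGrpCat.isZero_iff_subsingleton.1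
    ((fieldTensor 𝒜 j).isZero_leftDerived_obj_projective_succ n P)

theorem exists_projective_cover (M : GrMod 𝒜) :
    ∃ (K P : GrMod 𝒜) (f : K ⟶ P) (g : P ⟶ M), Projective P ∧ IsShortExact f g :=
  ⟨_, Projective.over M, kerι (Projective.π M), Projective.π M, inferInstance,
    isShortExact_kerι _ (surjective_of_epi _)⟩

theorem torVanishes_of_hasProjectiveDimensionLT (n : ℕ) (M : GrMod 𝒜)
    (hM : HasProjectiveDimensionLT M (n + 1)) {i : ℕ} (hi : n < i) (j : ℤ) :
    TorVanishes M i j := by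
  induction n generalizing M i with
  | zero =>
    obtain ⟨i, rfl⟩ := Nat.exists_eq_add_of_lt hi
    rw [zero_add]
    exact torVanishes_of_projective M (projective_iff_hasProjectiveDimensionLT_one.2 hM) i j
  | succ n ih =>
    obtain ⟨K, P, f, g, hP, h⟩ := M.exists_projective_cover
    obtain ⟨i, rfl⟩ := Nat.exists_eq_add_of_le' (show 2 ≤ i by omega)
    rw [torVanishes_add_two_iff h hP]
    exact ih K ((h.shortExact.hasProjectiveDimensionLT_X₃_iff n hP).1 hM) (by omega)

/-! ### Vanishing along the long exact sequence of Tor -/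

section LongExact

/-- Rotation of a short exact sequence. Given `0 ⟶ K ⟶ F ⟶ M ⟶ 0` and a projective cover of `F`,
which also covers `M`, the kernels `F'` and `M'` of the two covers fit into
`0 ⟶ F' ⟶ M' ⟶ K ⟶ 0`. The last two conclusions record
the commutation of the maps between these sequences. -/
theorem IsShortExact.exists_rotation {K F M : GrMod 𝒜} {f : K ⟶ F} {g : F ⟶ M}
    (h : IsShortExact f g) :
    ∃ (P F' M' : GrMod 𝒜) (q : P ⟶ F) (a : F' ⟶ P) (b : M' ⟶ P) (c : F' ⟶ M') (d : M' ⟶ K),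
      Projective P ∧ IsShortExact a q ∧ IsShortExact b (q ≫ g) ∧ IsShortExact c d ∧
      c ≫ b = a ∧ b ≫ q = d ≫ f := by
  let q := Projective.π F
  have hq : Function.Surjective (lin q) := surjective_of_epi q
  have hle : LinearMap.ker (lin q) ≤ LinearMap.ker (lin (q ≫ g)) := fun x hx => by
    rw [LinearMap.mem_ker] at hx ⊢
    rw [lin_comp, LinearMap.comp_apply, hx, map_zero]
  let c : ker q ⟶ ker (q ≫ g) := mkHom (M := ker q) (N := ker (q ≫ g))
    (Submodule.inclusion hle) (fun _ _ hx => hx)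
  have hd : (kerι (q ≫ g) ≫ q) ≫ g = 0 := by rw [Category.assoc, kerι_comp]
  let d : ker (q ≫ g) ⟶ K := h.shortExact.fIsKernel.lift
    (KernelFork.ofι (kerι (q ≫ g) ≫ q) hd)
  have hdf : d ≫ f = kerι (q ≫ g) ≫ q := h.shortExact.fIsKernel.fac _ WalkingParallelPair.zero
  have hdf' : ∀ x : (ker (q ≫ g)).carrier, lin f (lin d x) = lin q x.1 := fun x =>
    congrArg (fun t => lin t x) hdf
  refine ⟨Projective.over F, ker q, ker (q ≫ g), q, kerι q, kerι (q ≫ g), c, d, inferInstance,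
    isShortExact_kerι q hq, isShortExact_kerι (q ≫ g) (h.surjective.comp hq), ⟨?_, ?_, ?_⟩,
    rfl, hdf.symm⟩
  · exact Submodule.inclusion_injective hle
  · intro x
    obtain ⟨y, hy⟩ := hq (lin f x)
    have hy' : y ∈ LinearMap.ker (lin (q ≫ g)) := by
      rw [LinearMap.mem_ker, lin_comp, LinearMap.comp_apply, hy, h.lin_lin]
    exact ⟨⟨y, hy'⟩, h.injective ((hdf' _).trans hy)⟩
  · intro y
    constructor
    · intro hy
      have : lin q y.1 = 0 := by rw [← hdf', hy, map_zero]
      exact ⟨⟨y.1, this⟩, rfl⟩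
    · rintro ⟨x, rfl⟩
      apply h.injective
      rw [hdf', map_zero]
      exact x.2

variable {K F M : GrMod 𝒜} {f : K ⟶ F} {g : F ⟶ M}

/-- If `Tor_1(M)_j = 0`, then `K / A_{≥1} K ⟶ F / A_{≥1} F` is injective in degree `j`; here `F` need
not be projective. -/
theorem mem_radical_of_lin_mem (h : IsShortExact f g) {j : ℤ} (hM : TorVanishes M 1 j) :
    ∀ x ∈ K.deg j, lin f x ∈ F.radical j → x ∈ K.radical j := by
  intro x hx hfx
  obtain ⟨P, F', M', q, a, b, c, d, hP, ha, hb, hc, hcb, hbq⟩ := h.exists_rotation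
  have hcb' : ∀ t, lin b (lin c t) = lin a t := fun t => congrArg (fun s => lin s t) hcb
  have hbq' : ∀ t, lin q (lin b t) = lin f (lin d t) := fun t => congrArg (fun s => lin s t) hbq
  rw [torVanishes_one_iff hb hP] at hM
  obtain ⟨y, hy, rfl⟩ := exists_hom_preimage d hc.surjective hx
  obtain ⟨z, hz, hyz⟩ := ha.exists_sub_mem_radical (lin_mem b j hy) (by rwa [hbq'])
  have := hM (y - lin c z) (sub_mem hy (lin_mem c j hz)) (by rwa [map_sub, hcb'])
  have := lin_mem_radical d this
  rwa [map_sub, hc.lin_lin, sub_zero] at this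

/-- A partial converse to `mem_radical_of_lin_mem`. -/
theorem torVanishes_one_of_injective (h : IsShortExact f g) {j : ℤ} (hF : TorVanishes F 1 j)
    (hK : ∀ x ∈ K.deg j, lin f x ∈ F.radical j → x ∈ K.radical j) : TorVanishes M 1 j := by
  obtain ⟨P, F', M', q, a, b, c, d, hP, ha, hb, hc, hcb, hbq⟩ := h.exists_rotation
  have hcb' : ∀ t, lin b (lin c t) = lin a t := fun t => congrArg (fun s => lin s t) hcb
  have hbq' : ∀ t, lin q (lin b t) = lin f (lin d t) := fun t => congrArg (fun s => lin s t) hbq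
  rw [torVanishes_one_iff ha hP] at hF
  rw [torVanishes_one_iff hb hP]
  intro y hy hby
  have h1 : lin d y ∈ K.radical j := hK _ (lin_mem d j hy) (by
    rw [← hbq']
    exact lin_mem_radical q hby)
  obtain ⟨z, hz, hyz⟩ := hc.exists_sub_mem_radical hy h1
  have h2 : lin a z ∈ P.radical j := by
    have := lin_mem_radical b hyz
    rw [map_sub, hcb'] at this
    have := sub_mem hby this
    rwa [sub_sub_cancel] at this
  have := add_mem hyz (lin_mem_radical c (hF z hz h2))
  rwa [sub_add_cancel] at this

theorem IsShortExact.torVanishes_one_middle (h : IsShortExact f g) {j : ℤ}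
    (hK : TorVanishes K 1 j) (hM : TorVanishes M 1 j) : TorVanishes F 1 j := by
  obtain ⟨P, F', M', q, a, b, c, d, hP, ha, hb, hc, hcb, hbq⟩ := h.exists_rotation
  have hcb' : ∀ t, lin b (lin c t) = lin a t := fun t => congrArg (fun s => lin s t) hcb
  rw [torVanishes_one_iff hb hP] at hM
  rw [torVanishes_one_iff ha hP]
  intro x hx hax
  refine mem_radical_of_lin_mem hc hK x hx (hM _ (lin_mem c j hx) ?_)
  rwa [hcb']

theorem IsShortExact.torVanishes_one_left (h : IsShortExact f g) {j : ℤ}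
    (hM : TorVanishes M 2 j) (hF : TorVanishes F 1 j) : TorVanishes K 1 j := by
  obtain ⟨P, F', M', q, a, b, c, d, hP, ha, hb, hc, hcb, hbq⟩ := h.exists_rotation
  have hcb' : ∀ t, lin b (lin c t) = lin a t := fun t => congrArg (fun s => lin s t) hcb
  refine torVanishes_one_of_injective hc ((torVanishes_add_two_iff hb hP 0 j).1 hM)
    fun x hx hcx => ?_
  rw [torVanishes_one_iff ha hP] at hF
  refine hF x hx ?_
  rw [← hcb']
  exact lin_mem_radical b hcx

theorem IsShortExact.torVanishes_zero_middle (h : IsShortExact f g) {j : ℤ}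
    (hK : TorVanishes K 0 j) (hM : TorVanishes M 0 j) : TorVanishes F 0 j := by
  rw [torVanishes_zero_iff] at *
  intro y hy
  obtain ⟨x, hx, hxy⟩ := h.exists_sub_mem_radical hy (hM (lin_mem g j hy))
  have := add_mem hxy (lin_mem_radical f (hK hx))
  rwa [sub_add_cancel] at this

theorem IsShortExact.torVanishes_zero_left (h : IsShortExact f g) {j : ℤ}
    (hM : TorVanishes M 1 j) (hF : TorVanishes F 0 j) : TorVanishes K 0 j := by
  rw [torVanishes_zero_iff] at *
  exact fun x hx => mem_radical_of_lin_mem h hM x hx (hF (lin_mem f j hx))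

theorem IsShortExact.torVanishes_zero_right (h : IsShortExact f g) {j : ℤ}
    (hF : TorVanishes F 0 j) : TorVanishes M 0 j := by
  rw [torVanishes_zero_iff] at *
  intro y hy
  obtain ⟨x, hx, rfl⟩ := exists_hom_preimage g h.surjective hy
  exact lin_mem_radical g (hF hx)

/-- Vanishing at the middle and at the left term of the long exact sequence of Tor. The two are
proved together: rotating the short exact sequence once turns the statement for the middle term
into the one for the left term in lower degree, and rotating it twice does the converse. -/
theorem torVanishes_middle_and_left (i : ℕ) (j : ℤ) :
    (∀ {K F M : GrMod 𝒜} {f : K ⟶ F} {g : F ⟶ M}, IsShortExact f g →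
      TorVanishes K i j → TorVanishes M i j → TorVanishes F i j) ∧
    (∀ {K F M : GrMod 𝒜} {f : K ⟶ F} {g : F ⟶ M}, IsShortExact f g →
      TorVanishes M (i + 1) j → TorVanishes F i j → TorVanishes K i j) := by
  induction i using Nat.strong_induction_on with | _ i ih
  match i, ih with
  | 0, _ => exact ⟨fun h => h.torVanishes_zero_middle, fun h => h.torVanishes_zero_left⟩
  | 1, _ => exact ⟨fun h => h.torVanishes_one_middle, fun h => h.torVanishes_one_left⟩
  | i + 2, ih =>
    constructor
    · intro K F M f g h hK hM
      obtain ⟨P, F', M', q, a, b, c, d, hP, ha, hb, hc, -⟩ := h.exists_rotation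
      rw [torVanishes_add_two_iff hb hP] at hM
      rw [torVanishes_add_two_iff ha hP]
      exact (ih (i + 1) (by omega)).2 hc hK hM
    · intro K F M f g h hM hF
      obtain ⟨P, F', M', q, a, b, c, d, hP, ha, hb, hc, -⟩ := h.exists_rotation
      obtain ⟨P₁, F₁, M₁, q₁, a₁, b₁, c₁, d₁, hP₁, ha₁, hb₁, hc₁, -⟩ := hc.exists_rotation
      rw [torVanishes_add_two_iff hb hP, torVanishes_add_two_iff ha₁ hP₁] at hM
      rw [torVanishes_add_two_iff ha hP] at hF
      rw [torVanishes_add_two_iff hb₁ hP₁]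
      exact (ih (i + 1) (by omega)).1 hc₁ hM hF

theorem IsShortExact.torVanishes_middle (h : IsShortExact f g) {i : ℕ} {j : ℤ}
    (hK : TorVanishes K i j) (hM : TorVanishes M i j) : TorVanishes F i j :=
  (torVanishes_middle_and_left i j).1 h hK hM

theorem IsShortExact.torVanishes_left (h : IsShortExact f g) {i : ℕ} {j : ℤ}
    (hM : TorVanishes M (i + 1) j) (hF : TorVanishes F i j) : TorVanishes K i j :=
  (torVanishes_middle_and_left i j).2 h hM hF

theorem IsShortExact.torVanishes_right (h : IsShortExact f g) {i : ℕ} {j : ℤ}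
    (hF : TorVanishes F (i + 1) j) (hK : TorVanishes K i j) : TorVanishes M (i + 1) j := by
  cases i with
  | zero =>
    rw [torVanishes_zero_iff] at hK
    exact torVanishes_one_of_injective h hF fun x hx _ => hK hx
  | succ i =>
    obtain ⟨P, F', M', q, a, b, c, d, hP, ha, hb, hc, -⟩ := h.exists_rotation
    rw [torVanishes_add_two_iff ha hP] at hF
    rw [torVanishes_add_two_iff hb hP]
    exact hc.torVanishes_middle hF hK

end LongExact

end Tor

end GrMod

/-! ### Shifts and finite direct sums -/

section Additive

universe v' u'

variable {C : Type u'} [Category.{v'} C] [Abelian C]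

/-- An additive functor kills an object whose identity is a finite sum of morphisms factoring
through objects that it kills. -/
theorem isZero_obj_of_id_eq_sum {D : Type*} [Category* D] [Abelian D] (G : C ⥤ D) [G.Additive]
    {ι : Type*} (s : Finset ι) {X : C} (Y : ι → C) (p : ∀ t, X ⟶ Y t) (q : ∀ t, Y t ⟶ X)
    (h : 𝟙 X = ∑ t ∈ s, p t ≫ q t) (hY : ∀ t, IsZero (G.obj (Y t))) : IsZero (G.obj X) := by
  rw [IsZero.iff_id_eq_zero, ← G.map_id, h, G.map_sum]
  refine Finset.sum_eq_zero fun t _ => ?_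
  rw [G.map_comp, (hY t).eq_of_tgt (G.map (p t)) 0, zero_comp]

variable [EnoughProjectives C]

instance : (projectiveResolutions C).Additive where
  map_add {X Y f g} := by
    change (HomotopyCategory.quotient _ _).map _ =
      (HomotopyCategory.quotient _ _).map _ + (HomotopyCategory.quotient _ _).map _
    refine Eq.trans ?_ ((HomotopyCategory.quotient C (ComplexShape.down ℕ)).map_add
      (f := ProjectiveResolution.lift f (projectiveResolution X) (projectiveResolution Y))
      (g := ProjectiveResolution.lift g (projectiveResolution X) (projectiveResolution Y)))
    refine HomotopyCategory.eq_of_homotopy _ _ (ProjectiveResolution.liftHomotopy (f + g) _ _ ?_ ?_)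
    · simp
    · simp [Preadditive.add_comp, Preadditive.comp_add]

instance {D : Type*} [Category* D] [Abelian D] (G : C ⥤ D) [G.Additive] (n : ℕ) :
    (G.leftDerived n).Additive := by
  unfold Functor.leftDerived Functor.leftDerivedToHomotopyCategory
  infer_instance

end Additive

namespace GrMod

section Shift

variable {k : Type w} {A : Type u} [Field k] [Ring A] [Algebra k A] {𝒜 : ℕ → Submodule k A}

theorem lin_sum {ι : Type*} (s : Finset ι) {M N : GrMod 𝒜} (f : ι → (M ⟶ N)) (x : M.carrier) :
    lin (∑ t ∈ s, f t) x = ∑ t ∈ s, lin (f t) x := by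
  classical
  induction s using Finset.induction_on with
  | empty => rfl
  | insert a s ha ih => rw [Finset.sum_insert ha, Finset.sum_insert ha, lin_add, ← ih]; rfl

/-- A morphism, shifted. -/
def shiftHom {M N : GrMod 𝒜} (f : M ⟶ N) (l : ℤ) : M.shift l ⟶ N.shift l :=
  mkHom (M := M.shift l) (N := N.shift l) (lin (M := M) (N := N) f) fun _ _ hx => lin_mem f _ hx

theorem IsShortExact.shift {K F M : GrMod 𝒜} {f : K ⟶ F} {g : F ⟶ M} (h : IsShortExact f g)
    (l : ℤ) : IsShortExact (shiftHom f l) (shiftHom g l) :=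
  ⟨h.injective, h.surjective, h.exact⟩

theorem radical_shift (M : GrMod 𝒜) (l j : ℤ) : (M.shift l).radical j = M.radical (j + l) := by
  refine congrArg AddSubgroup.closure (Set.ext fun y => ⟨?_, ?_⟩)
  · rintro ⟨i, n, a, x, hi, ha, hx, hj, rfl⟩
    exact ⟨i, n + l, a, x, hi, ha, hx, by omega, rfl⟩
  · rintro ⟨i, n, a, x, hi, ha, hx, hj, rfl⟩
    refine ⟨i, n - l, a, x, hi, ha, ?_, by omega, rfl⟩
    change x ∈ M.deg (n - l + l)
    rwa [sub_add_cancel]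

theorem projective_shift {P : GrMod 𝒜} (hP : Projective P) (l : ℤ) : Projective (P.shift l) where
  factors {E X} f e _ := by
    -- Shift the lifting problem by `-l`.
    let f' : P ⟶ X.shift (-l) := mkHom (M := P) (N := X.shift (-l)) (lin (M := P.shift l) (N := X) f)
      fun n x hx => by
      refine lin_mem f (n + -l) (?_ : x ∈ P.deg (n + -l + l))
      rwa [neg_add_cancel_right]
    have he : Epi (shiftHom e (-l)) :=
      epi_of_surjective (M := E.shift (-l)) (N := X.shift (-l)) _
        (surjective_of_epi (M := E) (N := X) e)
    obtain ⟨r, hr⟩ := hP.factors f' (shiftHom e (-l))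
    refine ⟨mkHom (M := P.shift l) (N := E) (lin (M := P) (N := E.shift (-l)) r)
      fun n x hx => ?_, hom_ext fun x => ?_⟩
    · have := lin_mem (M := P) (N := E.shift (-l)) r (n + l) hx
      change _ ∈ E.deg (n + l + -l) at this
      rwa [add_neg_cancel_right] at this
    · exact congrArg (fun t : P ⟶ X.shift (-l) => lin (M := P) (N := X.shift (-l)) t x) hr

variable [GradedAlgebra 𝒜]

theorem torVanishes_shift (M : GrMod 𝒜) (l : ℤ) (i : ℕ) (j : ℤ) :
    TorVanishes (M.shift l) i j ↔ TorVanishes M i (j + l) := by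
  obtain _ | i := i
  · rw [torVanishes_zero_iff, torVanishes_zero_iff, radical_shift]
    rfl
  induction i generalizing M with
  | zero =>
    obtain ⟨K, P, f, g, hP, h⟩ := M.exists_projective_cover
    rw [torVanishes_one_iff h hP, torVanishes_one_iff (h.shift l) (projective_shift hP l),
      radical_shift, radical_shift]
    rfl
  | succ i ih =>
    obtain ⟨K, P, f, g, hP, h⟩ := M.exists_projective_cover
    rw [torVanishes_add_two_iff h hP, torVanishes_add_two_iff (h.shift l) (projective_shift hP l)]
    exact ih K

theorem torVanishes_of_iso {M N : GrMod 𝒜} (e : M ≅ N) {i : ℕ} {j : ℤ} (h : TorVanishes M i j) :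
    TorVanishes N i j :=
  AddCommGrpCat.isZero_iff_subsingleton.1 ((((fieldTensor 𝒜 j).leftDerived i).mapIso e).isZero_iff.1
    (AddCommGrpCat.isZero_iff_subsingleton.2 h))

end Shift

section Free

variable {k : Type w} {A : Type u} [Field k] [Ring A] [Algebra k A] {𝒜 : ℕ → Submodule k A}
  [GradedAlgebra 𝒜]

/-- The projection of a graded free module to one of its summands. -/
noncomputable def freeFst {ι : Type u} (d : ι → ℤ) (s : ι) :
    free 𝒜 d ⟶ (regular 𝒜).shift (-d s) :=
  mkHom (M := free 𝒜 d) (N := (regular 𝒜).shift (-d s)) (Finsupp.lapply s) fun _ _ hx => hx s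

/-- The inclusion of a summand of a graded free module. -/
noncomputable def freeSingle {ι : Type u} (d : ι → ℤ) (s : ι) :
    (regular 𝒜).shift (-d s) ⟶ free 𝒜 d :=
  mkHom (M := (regular 𝒜).shift (-d s)) (N := free 𝒜 d) (Finsupp.lsingle s) fun n (x : A) hx t => by
    classical
    change (Finsupp.single s x : ι →₀ A) t ∈ _
    by_cases h : s = t
    · subst h
      rw [Finsupp.single_eq_same]
      exact hx
    · rw [Finsupp.single_eq_of_ne (Ne.symm h)]
      exact zero_mem _

end Free

/-! ### Restriction of scalars -/

section Restrict

variable {k : Type w} {T A : Type u} [Field k] [Ring T] [Algebra k T] [Ring A] [Algebra k A]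
  {𝒯 : ℕ → Submodule k T} {𝒜 : ℕ → Submodule k A}
  (φ : T →ₐ[k] A) (hφ : ∀ (n : ℕ), ∀ t ∈ 𝒯 n, φ t ∈ 𝒜 n)

/-- A morphism of graded `A`-modules, as a morphism of graded `T`-modules. -/
def restrictHom {M N : GrMod 𝒜} (f : M ⟶ N) : restrict φ hφ M ⟶ restrict φ hφ N :=
  mkHom (M := restrict φ hφ M) (N := restrict φ hφ N)
    { toFun := lin f
      map_add' := map_add (lin f)
      map_smul' := fun t (x : M.carrier) => map_smul (lin f) (φ t) x } fun n _ hx => lin_mem f n hx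

theorem IsShortExact.restrict {K F M : GrMod 𝒜} {f : K ⟶ F} {g : F ⟶ M} (h : IsShortExact f g) :
    IsShortExact (restrictHom φ hφ f) (restrictHom φ hφ g) :=
  ⟨h.injective, h.surjective, h.exact⟩

theorem radical_restrict_le (M : GrMod 𝒜) (j : ℤ) :
    (restrict φ hφ M).radical j ≤ M.radical j := by
  refine (AddSubgroup.closure_le (G := M.carrier) _).2 ?_
  rintro _ ⟨i, n, a, x, hi, ha, hx, hj, rfl⟩
  exact M.smul_mem_radical hi (hφ i a ha) hx hj

variable [GradedAlgebra 𝒯] [GradedAlgebra 𝒜]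

theorem torVanishes_zero_of_restrict {M : GrMod 𝒜} {j : ℤ}
    (h : TorVanishes (restrict φ hφ M) 0 j) : TorVanishes M 0 j := by
  rw [torVanishes_zero_iff] at *
  exact h.trans (radical_restrict_le φ hφ M j)

theorem torVanishes_restrict_free {ι : Type u} [Finite ι] (d : ι → ℤ) {i : ℕ} {j : ℤ}
    (h : ∀ s, TorVanishes (restrict φ hφ (regular 𝒜)) i (j - d s)) :
    TorVanishes (restrict φ hφ (free 𝒜 d)) i j := by
  have := Fintype.ofFinite ι
  refine AddCommGrpCat.isZero_iff_subsingleton.1 (isZero_obj_of_id_eq_sum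
    ((fieldTensor 𝒯 j).leftDerived i) Finset.univ
    (fun s => (restrict φ hφ (regular 𝒜)).shift (-d s))
    (fun s => restrictHom φ hφ (freeFst d s)) (fun s => restrictHom φ hφ (freeSingle d s)) ?_
    fun s => AddCommGrpCat.isZero_iff_subsingleton.2 ((torVanishes_shift _ _ _ _).2
      (by rw [← sub_eq_add_neg]; exact h s)))
  refine hom_ext fun (x : ι →₀ A) => ?_
  refine Eq.trans ?_ (lin_sum Finset.univ
    (fun s => restrictHom φ hφ (freeFst d s) ≫ restrictHom φ hφ (freeSingle d s)) x).symm
  exact (Finsupp.univ_sum_single x).symm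

end Restrict

end GrMod

/-! ### Minimal covers -/

namespace GrMod

section Minimal

variable {k : Type w} {A : Type u} [Field k] [Ring A] [Algebra k A] {𝒜 : ℕ → Submodule k A}

theorem exists_homogeneous_generators (M : GrMod 𝒜) [Module.Finite A M.carrier] :
    ∃ S : Finset M.carrier, (∀ v ∈ S, ∃ n, v ∈ M.deg n) ∧
      Submodule.span A (S : Set M.carrier) = ⊤ := by
  classical
  obtain ⟨S, hS⟩ := Module.Finite.fg_top (R := A) (M := M.carrier)
  choose s hs using M.exists_sum_proj
  refine ⟨S.biUnion fun x => (s x).image fun n => M.proj n x, fun v hv => ?_, ?_⟩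
  · obtain ⟨x, -, hx⟩ := Finset.mem_biUnion.1 hv
    obtain ⟨n, -, rfl⟩ := Finset.mem_image.1 hx
    exact ⟨n, M.proj_mem n x⟩
  · rw [eq_top_iff, ← hS, Submodule.span_le]
    intro x hx
    rw [SetLike.mem_coe, hs x]
    exact sum_mem fun n hn => Submodule.subset_span
      (Finset.mem_biUnion.2 ⟨x, hx, Finset.mem_image.2 ⟨n, hn, rfl⟩⟩)

variable [GradedAlgebra 𝒜]

/-- An element of `A_{≥1} F` of degree `j` has no component along generators of degree at least
`j`. -/
theorem apply_eq_zero_of_mem_radical_free {ι : Type u} (d : ι → ℤ) {j : ℤ} {x : ι →₀ A}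
    (hx : x ∈ (free 𝒜 d).radical j) {s : ι} (hs : j ≤ d s) : x s = 0 := by
  have : (free 𝒜 d).radical j ≤ ((Finsupp.lapply s : (ι →₀ A) →ₗ[A] A).toAddMonoidHom).ker := by
    refine (AddSubgroup.closure_le (G := ι →₀ A) _).2 ?_
    rintro _ ⟨i, n, a, (x : ι →₀ A), hi, ha, hx, hj, rfl⟩
    have h0 : x s = 0 := by
      have h1 := hx s
      obtain ⟨m, hm⟩ := Int.eq_negSucc_of_lt_zero (show n - d s < 0 by omega)
      rw [hm] at h1
      exact h1
    change a * x s = 0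
    rw [h0, mul_zero]
  exact this hx

/-- A homogeneous element of a graded free module lies in `A_{≥1} F` as soon as its coefficients of
degree zero vanish. -/
theorem mem_radical_free {ι : Type u} (d : ι → ℤ) {j : ℤ} {x : ι →₀ A}
    (hx : x ∈ (free 𝒜 d).deg j) (h : ∀ s, d s = j → x s = 0) : x ∈ (free 𝒜 d).radical j := by
  have hsum : x = ∑ s ∈ x.support, Finsupp.single s (x s) := (Finsupp.sum_single x).symm
  rw [hsum]
  refine AddSubgroup.sum_mem (G := ι →₀ A) ((free 𝒜 d).radical j) fun s _ => ?_
  have hs := hx s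
  have hz : x s = 0 → (Finsupp.single s (x s) : ι →₀ A) ∈ (free 𝒜 d).radical j := by
    intro h0
    rw [h0, Finsupp.single_zero]
    exact zero_mem ((free 𝒜 d).radical j)
  generalize hm : j - d s = m at hs
  cases m with
  | ofNat m =>
    obtain _ | m := m
    · exact hz (h s (by simp at hm; omega))
    · have := (free 𝒜 d).smul_mem_radical (Nat.succ_pos m) hs (single_mem_free d s)
        (j := j) (by simp at hm; push_cast; omega)
      have he : x s • (Finsupp.single s 1 : ι →₀ A) = Finsupp.single s (x s) := by simp
      exact he ▸ this
  | negSucc m => exact hz hs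

/-- A finitely generated graded module has a cover by a finite graded free module whose generators
sit in degrees where `M / A_{≥1} M` is nonzero and whose kernel `K` lies in `A_{≥1} F`: map the
basis to a homogeneous generating set with as few elements as possible. -/
theorem exists_minimal_cover (hA : IsConnectedGraded 𝒜) [IsNoetherianRing A] (M : GrMod 𝒜)
    [Module.Finite A M.carrier] :
    ∃ (ι : Type u) (_ : Finite ι) (d : ι → ℤ) (K : GrMod 𝒜) (f : K ⟶ free 𝒜 d)
      (g : free 𝒜 d ⟶ M), IsShortExact f g ∧ Module.Finite A K.carrier ∧
      (∀ s, ¬ TorVanishes M 0 (d s)) ∧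
      ∀ j, ∀ x ∈ K.deg j, lin f x ∈ (free 𝒜 d).radical j := by
  classical
  have := hA.nontrivial
  obtain ⟨S, ⟨hSh, hSs⟩, hmin⟩ := (measure (Finset.card (α := M.carrier))).wf.has_min
    {S | (∀ v ∈ S, ∃ n, v ∈ M.deg n) ∧ Submodule.span A (S : Set M.carrier) = ⊤}
    M.exists_homogeneous_generators
  choose d hd using fun s : S => hSh s.1 s.2
  let g : free 𝒜 d ⟶ M := freeDesc d M (fun s => s.1) hd
  have hg (x : S →₀ A) : lin g x = Finsupp.linearCombination A (fun s : S => s.1) x := rfl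
  have hsurj : Function.Surjective (lin g) := by
    rw [← LinearMap.range_eq_top]
    refine (Finsupp.range_linearCombination A (v := fun s : S => s.1)).trans ?_
    rw [← hSs]
    simp
  -- A coefficient of degree zero in a relation is a scalar; were it nonzero, the corresponding
  -- generator could be dropped.
  have hker (j : ℤ) (x : S →₀ A) (hx : x ∈ (free 𝒜 d).deg j) (hgx : lin g x = 0) :
      x ∈ (free 𝒜 d).radical j := by
    refine mem_radical_free d hx fun s hs => ?_
    have hxs : x s ∈ 𝒜 0 := by
      have := hx s
      rw [hs, sub_self] at this
      exact this
    rw [hA.zero_eq, Submodule.mem_one] at hxs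
    obtain ⟨c, hc⟩ := hxs
    by_contra hne
    have hc0 : c ≠ 0 := by
      rintro rfl
      rw [map_zero] at hc
      exact hne hc.symm
    refine hmin (S.erase s.1) ⟨fun v hv => hSh v (Finset.mem_of_mem_erase hv), ?_⟩
      (Finset.card_erase_lt_of_mem s.2)
    have hmem : ∀ v ∈ S, v ≠ s.1 → v ∈ Submodule.span A ((S.erase s.1 : Finset M.carrier) :
        Set M.carrier) := fun v hv hvs =>
      Submodule.subset_span (Finset.mem_coe.2 (Finset.mem_erase.2 ⟨hvs, hv⟩))
    have hsmem : (s.1 : M.carrier) ∈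
        Submodule.span A ((S.erase s.1 : Finset M.carrier) : Set M.carrier) := by
      have h1 : x s • s.1 = -∑ t ∈ x.support.erase s, x t • t.1 := by
        rw [eq_neg_iff_add_eq_zero, Finset.add_sum_erase _ (fun t => x t • t.1)
          (Finsupp.mem_support_iff.2 hne), ← hgx, hg]
        rfl
      have h2 : s.1 = algebraMap k A c⁻¹ • (x s • s.1) := by
        rw [← hc, smul_smul, ← map_mul, inv_mul_cancel₀ hc0, map_one, one_smul]
      have h3 : -∑ t ∈ x.support.erase s, x t • t.1 ∈
          Submodule.span A ((S.erase s.1 : Finset M.carrier) : Set M.carrier) := by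
        refine neg_mem (sum_mem fun t ht => Submodule.smul_mem _ _ ?_)
        exact hmem t.1 t.2 fun h => (Finset.mem_erase.1 ht).1 (Subtype.ext h)
      rw [← h1] at h3
      have h4 := Submodule.smul_mem _ (algebraMap k A c⁻¹) h3
      rwa [← h2] at h4
    rw [eq_top_iff, ← hSs, Submodule.span_le]
    intro v hv
    by_cases hvs : v = s.1
    · exact hvs ▸ hsmem
    · exact hmem v hv hvs
  refine ⟨S, inferInstance, d, ker g, kerι g, g, isShortExact_kerι g hsurj, ?_, fun s hs => ?_,
    fun j x hx => hker j x.1 hx x.2⟩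
  · have : IsNoetherian A (free 𝒜 d).carrier := inferInstanceAs (IsNoetherian A (S →₀ A))
    exact inferInstanceAs (Module.Finite A (LinearMap.ker (lin g)))
  · rw [torVanishes_zero_iff] at hs
    obtain ⟨z, hz, hzs⟩ := exists_mem_radical g hsurj (hs (hd s))
    have h1 : lin g (Finsupp.single s 1 : S →₀ A) = s.1 := by
      rw [hg, Finsupp.linearCombination_single, one_smul]
    let e : (free 𝒜 d).carrier := (Finsupp.single s 1 : S →₀ A)
    have h2 : e - z ∈ (free 𝒜 d).radical (d s) :=
      hker (d s) (e - z) (sub_mem (single_mem_free d s) (radical_le_deg _ _ hz)) (by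
        rw [map_sub, hzs]
        exact sub_eq_zero.2 h1)
    have h3 := add_mem h2 hz
    rw [sub_add_cancel] at h3
    have h4 := apply_eq_zero_of_mem_radical_free d h3 le_rfl
    exact one_ne_zero (Finsupp.single_eq_same.symm.trans h4)

/-- For the kernel `K` of a minimal cover of `M`, the shift from `Tor_{i+1}(M)` to `Tor_i(K)` also
works for `i = 0`, since `K / A_{≥1} K ⟶ F / A_{≥1} F` is then zero. -/
theorem IsShortExact.torVanishes_kernel {K F M : GrMod 𝒜} {f : K ⟶ F} {g : F ⟶ M}
    (h : IsShortExact f g) (hF : Projective F) {i : ℕ} {j : ℤ}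
    (hmin : ∀ x ∈ K.deg j, lin f x ∈ F.radical j) (hM : TorVanishes M (i + 1) j) :
    TorVanishes K i j := by
  cases i with
  | zero =>
    rw [torVanishes_one_iff h hF] at hM
    rw [torVanishes_zero_iff]
    exact fun x hx => hM x hx (hmin x hx)
  | succ i => exact (torVanishes_add_two_iff h hF i j).1 hM

end Minimal

/-! ### Comparison of Tor over the two algebras -/

section ChangeOfRings

variable {k : Type w} {T A : Type u} [Field k] [Ring T] [Algebra k T] [Ring A] [Algebra k A]
  {𝒯 : ℕ → Submodule k T} {𝒜 : ℕ → Submodule k A} [GradedAlgebra 𝒯] [GradedAlgebra 𝒜]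
  (φ : T →ₐ[k] A) (hφ : ∀ (n : ℕ), ∀ t ∈ 𝒯 n, φ t ∈ 𝒜 n)

/-- The consequence for vanishing of the change of rings spectral sequence
`Tor^A_p(Tor^T_q(𝕜, A), M) ⇒ Tor^T_{p+q}(𝕜, M)`, obtained by induction along a minimal resolution
of `M` over `A`. -/
theorem exists_tor_of_tor_restrict (hA : IsConnectedGraded 𝒜) [IsNoetherianRing A] (M : GrMod 𝒜)
    [Module.Finite A M.carrier] {s : ℕ} {j : ℤ} (h : ¬ TorVanishes (restrict φ hφ M) s j) :
    ∃ (p q : ℕ) (e : ℤ), p + q = s ∧ ¬ TorVanishes M p e ∧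
      ¬ TorVanishes (restrict φ hφ (regular 𝒜)) q (j - e) := by
  induction s generalizing M with
  | zero =>
    obtain ⟨ι, _, d, K, f, g, hfg, hK, hd, hmin⟩ := M.exists_minimal_cover hA
    by_contra hc
    exact h ((hfg.restrict φ hφ).torVanishes_zero_right (torVanishes_restrict_free φ hφ d
      fun t => by_contra fun ht => hc ⟨0, 0, d t, rfl, hd t, ht⟩))
  | succ s ih =>
    obtain ⟨ι, _, d, K, f, g, hfg, hK, hd, hmin⟩ := M.exists_minimal_cover hA
    by_cases hKs : TorVanishes (restrict φ hφ K) s j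
    · by_contra hc
      exact h ((hfg.restrict φ hφ).torVanishes_right (torVanishes_restrict_free φ hφ d
        fun t => by_contra fun ht => hc ⟨0, s + 1, d t, by omega, hd t, ht⟩) hKs)
    · obtain ⟨p, q, e, hpq, hp, hq⟩ := ih K hKs
      exact ⟨p + 1, q, e, by omega,
        fun hM => hp (hfg.torVanishes_kernel inferInstance (hmin e) hM), hq⟩

/-- If `A` is linear over `T`, nonvanishing Tor over `A` is matched by nonvanishing Tor over `T` of
at least the same regularity, in lower or equal homological degree. -/
theorem exists_tor_restrict_of_tor (hA : IsConnectedGraded 𝒜) [IsNoetherianRing A]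
    (hlin : ∀ (i : ℕ) (j : ℤ), ¬ TorVanishes (restrict φ hφ (regular 𝒜)) i j → j ≤ i)
    (M : GrMod 𝒜) [Module.Finite A M.carrier] {s : ℕ} {j : ℤ} (h : ¬ TorVanishes M s j) :
    ∃ (i : ℕ) (e : ℤ), i ≤ s ∧ j - s ≤ e - i ∧ ¬ TorVanishes (restrict φ hφ M) i e := by
  induction s generalizing M with
  | zero => exact ⟨0, j, le_rfl, le_rfl, fun h' => h (torVanishes_zero_of_restrict φ hφ h')⟩
  | succ s ih =>
    obtain ⟨ι, _, d, K, f, g, hfg, hK, hd, hmin⟩ := M.exists_minimal_cover hA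
    have hKs : ¬ TorVanishes K s j := fun hK =>
      h (hfg.torVanishes_right (torVanishes_of_projective _ inferInstance s j) hK)
    obtain ⟨i, e, his, hle, hi⟩ := ih K hKs
    by_cases hM : TorVanishes (restrict φ hφ M) (i + 1) e
    · have hF : ¬ TorVanishes (restrict φ hφ (free 𝒜 d)) i e := fun hF =>
        hi ((hfg.restrict φ hφ).torVanishes_left hM hF)
      obtain ⟨t, ht⟩ : ∃ t, ¬ TorVanishes (restrict φ hφ (regular 𝒜)) i (e - d t) := by
        by_contra hc
        exact hF (torVanishes_restrict_free φ hφ d (not_exists_not.1 hc))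
      have := hlin i _ ht
      exact ⟨0, d t, Nat.zero_le _, by push_cast; omega,
        fun h' => hd t (torVanishes_zero_of_restrict φ hφ h')⟩
    · exact ⟨i + 1, e, by omega, by push_cast; omega, hM⟩

end ChangeOfRings

end GrMod

/-! ### Linear modules -/

namespace GrMod

section Linear

variable {k : Type w} {A : Type u} [Field k] [Ring A] [Algebra k A] {𝒜 : ℕ → Submodule k A}
  [GradedAlgebra 𝒜]

theorem deg_regular_le_radical {n : ℤ} (hn : n ≠ 0) :
    (regular 𝒜).deg n ≤ (regular 𝒜).radical n := by
  intro x hx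
  cases n with
  | ofNat m =>
    have hm : 0 < m := Nat.pos_of_ne_zero fun h => hn (by rw [h]; rfl)
    have h1 : (1 : A) ∈ (regular 𝒜).deg 0 := SetLike.one_mem_graded 𝒜
    have := (regular 𝒜).smul_mem_radical hm hx h1 (add_zero _)
    exact (mul_one (M := A) x) ▸ this
  | negSucc m => exact (show x = 0 from hx) ▸ zero_mem _

theorem torVanishes_of_hasLinearResolution {M : GrMod 𝒜} (hM : HasLinearResolution M)
    {i : ℕ} {j : ℤ} (hij : j ≠ i) : TorVanishes M i j := by
  obtain ⟨P, β, hP⟩ := hM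
  obtain ⟨e⟩ := hP i
  have h1 : IsZero ((fieldTensor 𝒜 j).obj (P.complex.X i)) := by
    refine (((fieldTensor 𝒜 j).mapIso e).isZero_iff).2 (isZero_obj_of_id_eq_sum _ Finset.univ
      (fun _ : Fin (β i) => (regular 𝒜).shift (-(i : ℤ))) (biproduct.π _) (biproduct.ι _)
      biproduct.total.symm fun _ => ?_)
    rw [AddCommGrpCat.isZero_iff_subsingleton, subsingleton_fieldTensor_iff, radical_shift]
    exact deg_regular_le_radical (by omega)
  refine AddCommGrpCat.isZero_iff_subsingleton.1
    (IsZero.of_iso ?_ (P.isoLeftDerivedObj (fieldTensor 𝒜 j) i))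
  erw [← HomologicalComplex.exactAt_iff_isZero_homology]
  exact ShortComplex.exact_of_isZero_X₂ _ h1

/-- The graded free module on finitely many generators of the same degree `n` is a direct sum of
copies of `A(-n)`. -/
theorem nonempty_free_iso_biproduct {ι : Type u} [Finite ι] (n : ℤ) :
    ∃ β : ℕ, Nonempty (free 𝒜 (fun _ : ι => n) ≅ ⨁ fun _ : Fin β => (regular 𝒜).shift (-n)) := by
  classical
  have := Fintype.ofFinite ι
  let e : Fin (Fintype.card ι) ≃ ι := (Fintype.equivFin ι).symm
  let b : Bicone (fun _ : Fin (Fintype.card ι) => (regular 𝒜).shift (-n)) :=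
    { pt := free 𝒜 (fun _ : ι => n)
      π := fun t => freeFst (fun _ : ι => n) (e t)
      ι := fun t => freeSingle (fun _ : ι => n) (e t)
      ι_π := fun t t' => by
        refine hom_ext fun (x : A) => ?_
        by_cases h : t = t'
        · subst h
          rw [dif_pos rfl]
          exact Finsupp.single_eq_same
        · rw [dif_neg h]
          exact Finsupp.single_eq_of_ne fun h' => h (e.injective h'.symm) }
  refine ⟨Fintype.card ι, ⟨biproduct.uniqueUpToIso _ (isBilimitOfTotal b ?_)⟩⟩
  refine hom_ext fun (x : ι →₀ A) => ?_
  refine (lin_sum Finset.univ (fun t => b.π t ≫ b.ι t) x).trans ?_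
  refine Eq.trans ?_ (Finsupp.univ_sum_single x)
  exact Fintype.sum_equiv e _ (fun s => (Finsupp.single s (x s) : ι →₀ A)) fun t => rfl

/-- Graded modules with a linear resolution starting in degree `n`, characterised by vanishing
conditions that pass to the kernel of a minimal cover: `M` is a finitely generated graded module
that vanishes below degree `n` and for which `Tor_i(𝕜, M)` vanishes above degree `n + i`. -/
structure IsLinearFrom (n : ℤ) (M : GrMod 𝒜) : Prop where
  finite : Module.Finite A M.carrier
  deg_eq_bot : ∀ j < n, M.deg j = ⊥
  torVanishes : ∀ (i : ℕ) (j : ℤ), n + i < j → TorVanishes M i j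

/-- The generators of a minimal cover have degree exactly `n`: at most `n` by the condition on
`Tor_0`, at least `n` since `M` vanishes below `n`. -/
theorem IsLinearFrom.exists_cover (hA : IsConnectedGraded 𝒜) [IsNoetherianRing A] {n : ℤ}
    {M : GrMod 𝒜} (hM : IsLinearFrom n M) :
    ∃ (K F : GrMod 𝒜) (f : K ⟶ F) (g : F ⟶ M) (β : ℕ), IsShortExact f g ∧
      IsLinearFrom (n + 1) K ∧ Projective F ∧
      Nonempty (F ≅ ⨁ fun _ : Fin β => (regular 𝒜).shift (-n)) := by
  have := hM.finite
  obtain ⟨ι, _, d, K, f, g, hfg, hK, hd, hmin⟩ := M.exists_minimal_cover hA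
  have hdn : d = fun _ => n := by
    funext s
    refine le_antisymm ?_ ?_
    · by_contra! hlt
      exact hd s (hM.torVanishes 0 (d s) (by simpa using hlt))
    · by_contra! hlt
      refine hd s ?_
      rw [torVanishes_zero_iff, hM.deg_eq_bot _ hlt]
      exact bot_le
  subst hdn
  obtain ⟨β, hβ⟩ := nonempty_free_iso_biproduct (𝒜 := 𝒜) (ι := ι) n
  refine ⟨K, _, f, g, β, hfg, ⟨hK, fun j hj => ?_, fun i j hij => ?_⟩, inferInstance, hβ⟩
  · rw [eq_bot_iff]
    intro x hx
    have h0 : lin f x = 0 := Finsupp.ext fun s =>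
      apply_eq_zero_of_mem_radical_free _ (hmin j x hx) (by omega)
    exact hfg.injective (h0.trans (map_zero _).symm)
  · exact hfg.torVanishes_kernel inferInstance (hmin j)
      (hM.torVanishes (i + 1) j (by push_cast; omega))

theorem IsLinearFrom.hasLinearResolution (hA : IsConnectedGraded 𝒜) [IsNoetherianRing A]
    {M : GrMod 𝒜} (hM : IsLinearFrom 0 M) : HasLinearResolution M := by
  have step : ∀ (n : ℕ) (N : {N : GrMod 𝒜 // IsLinearFrom (n : ℤ) N}),
      ∃ (K : {N : GrMod 𝒜 // IsLinearFrom ((n + 1 : ℕ) : ℤ) N}) (F : GrMod 𝒜) (f : K.1 ⟶ F)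
        (g : F ⟶ N.1) (β : ℕ), IsShortExact f g ∧ Projective F ∧
        Nonempty (F ≅ ⨁ fun _ : Fin β => (regular 𝒜).shift (-(n : ℤ))) := by
    rintro n ⟨N, hN⟩
    obtain ⟨K, F, f, g, β, hfg, hK, hF, e⟩ := hN.exists_cover hA
    exact ⟨⟨K, by push_cast; exact hK⟩, F, f, g, β, hfg, hF, e⟩
  choose K F f g β hfg hF e using step
  let Ω : ∀ n : ℕ, {N : GrMod 𝒜 // IsLinearFrom (n : ℤ) N} := Nat.rec ⟨M, hM⟩ K
  let S : SyzygySequence (GrMod 𝒜) :=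
    { Ω := fun n => (Ω n).1
      P := fun n => F n (Ω n)
      ι := fun n => f n (Ω n)
      π := fun n => g n (Ω n)
      zero := fun n => (hfg n (Ω n)).comp_eq_zero
      shortExact := fun n => (hfg n (Ω n)).shortExact
      projective := fun n => hF n (Ω n) }
  exact ⟨S.resolution, fun n => β n (Ω n), fun n => e n (Ω n)⟩

end Linear

/-! ### The trivial module and global dimension -/

section Trivial

variable {k : Type w} {A : Type u} [Field k] [Ring A] [Algebra k A] (𝒜 : ℕ → Submodule k A)
  [GradedAlgebra 𝒜]

instance finite_trivialModule : Module.Finite A (trivialModule 𝒜).carrier :=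
  inferInstanceAs (Module.Finite A (A ⧸ RingHom.ker (GradedRing.projZeroRingHom 𝒜)))

theorem deg_trivialModule_eq_bot {j : ℤ} (hj : j < 0) : (trivialModule 𝒜).deg j = ⊥ := by
  obtain ⟨m, rfl⟩ := Int.eq_negSucc_of_lt_zero hj
  rw [eq_bot_iff]
  rintro _ ⟨x, hx, rfl⟩
  exact (show x = 0 from hx) ▸ map_zero _

theorem not_torVanishes_trivialModule [Nontrivial A] : ¬ TorVanishes (trivialModule 𝒜) 0 0 := by
  rw [torVanishes_zero_iff]
  intro h
  let one : (trivialModule 𝒜).carrier :=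
    (Submodule.mkQ (RingHom.ker (GradedRing.projZeroRingHom 𝒜))) (1 : A)
  have h1 : one ∈ (trivialModule 𝒜).deg 0 := ⟨(1 : A), SetLike.one_mem_graded 𝒜, rfl⟩
  have h2 : (trivialModule 𝒜).radical 0 ≤ ⊥ := by
    refine (AddSubgroup.closure_le (G := (trivialModule 𝒜).carrier) _).2 ?_
    rintro _ ⟨i, n, a, x, hi, ha, hx, hj, rfl⟩
    obtain ⟨b, rfl⟩ := Submodule.Quotient.mk_surjective
      (RingHom.ker (GradedRing.projZeroRingHom 𝒜)) x
    refine (Submodule.Quotient.mk_eq_zero (RingHom.ker (GradedRing.projZeroRingHom 𝒜))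
      (x := a * b)).2 ?_
    rw [RingHom.mem_ker, map_mul]
    have : GradedRing.projZeroRingHom 𝒜 a = 0 := DirectSum.decompose_of_mem_ne 𝒜 ha hi.ne'
    rw [this, zero_mul]
  have h3 := (Submodule.Quotient.mk_eq_zero (RingHom.ker (GradedRing.projZeroRingHom 𝒜))
    (x := (1 : A))).1 (h2 (h h1))
  rw [RingHom.mem_ker, map_one] at h3
  exact one_ne_zero h3

theorem isKoszul_iff (hA : IsConnectedGraded 𝒜) [IsNoetherianRing A] :
    IsKoszul 𝒜 ↔ ∀ (i : ℕ) (j : ℤ), ¬ TorVanishes (trivialModule 𝒜) i j → j ≤ i := by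
  constructor
  · intro h i j hij
    by_contra hlt
    exact hij (torVanishes_of_hasLinearResolution h fun h' => hlt h'.le)
  · intro h
    refine IsLinearFrom.hasLinearResolution hA ⟨inferInstance,
      fun j hj => deg_trivialModule_eq_bot 𝒜 hj, fun i j hij => ?_⟩
    by_contra hne
    have := h i j hne
    omega

theorem exists_gradedGlobalDimension_eq [Nontrivial A] (h : gradedGlobalDimension 𝒜 < ⊤) :
    ∃ g : ℕ, gradedGlobalDimension 𝒜 = (g : WithBot ℕ∞) := by
  have hbot : gradedGlobalDimension 𝒜 ≠ ⊥ := by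
    intro hb
    have h1 : projectiveDimension (trivialModule 𝒜) = ⊥ :=
      le_bot_iff.1 (hb ▸ le_iSup (fun M : GrMod 𝒜 => projectiveDimension M) (trivialModule 𝒜))
    rw [projectiveDimension_eq_bot_iff] at h1
    exact not_torVanishes_trivialModule 𝒜 (AddCommGrpCat.isZero_iff_subsingleton.1
      (((fieldTensor 𝒜 0).leftDerived 0).map_isZero h1))
  generalize gradedGlobalDimension 𝒜 = x at h hbot
  induction x with
  | bot => exact absurd rfl hbot
  | coe x =>
    induction x with
    | top => exact absurd h (lt_irrefl _)
    | coe n => exact ⟨n, rfl⟩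

theorem torVanishes_of_gradedGlobalDimension_lt {g : ℕ}
    (h : gradedGlobalDimension 𝒜 = (g : WithBot ℕ∞)) (M : GrMod 𝒜) {i : ℕ} (hi : g < i) (j : ℤ) :
    TorVanishes M i j := by
  refine torVanishes_of_hasProjectiveDimensionLT g M ((projectiveDimension_le_iff M g).1 ?_) hi j
  rw [← h]
  exact le_iSup (fun M : GrMod 𝒜 => projectiveDimension M) M

end Trivial

section TrivialRestrict

variable {k : Type w} {T A : Type u} [Field k] [Ring T] [Algebra k T] [Ring A] [Algebra k A]
  {𝒯 : ℕ → Submodule k T} {𝒜 : ℕ → Submodule k A} [GradedAlgebra 𝒯] [GradedAlgebra 𝒜]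
  (φ : T →ₐ[k] A) (hφ : ∀ (n : ℕ), ∀ t ∈ 𝒯 n, φ t ∈ 𝒜 n)

include hφ in
theorem proj_zero_map (t : T) : GradedRing.proj 𝒜 0 (φ t) = φ (GradedRing.proj 𝒯 0 t) := by
  induction t using DirectSum.Decomposition.inductionOn 𝒯 with
  | zero => simp
  | @homogeneous i x =>
    by_cases h : i = 0
    · subst h
      exact (DirectSum.decompose_of_mem_same 𝒜 (hφ _ _ x.2)).trans
        (congrArg φ (DirectSum.decompose_of_mem_same 𝒯 x.2)).symm
    · exact (DirectSum.decompose_of_mem_ne 𝒜 (hφ _ _ x.2) h).trans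
        ((congrArg φ (DirectSum.decompose_of_mem_ne 𝒯 x.2 h)).trans (map_zero φ)).symm
  | add x y hx hy => rw [map_add, map_add, hx, hy, map_add, map_add]

/-- For connected graded algebras, restriction of scalars preserves the trivial module. -/
theorem nonempty_trivialModule_iso_restrict (hT : IsConnectedGraded 𝒯)
    (hA : IsConnectedGraded 𝒜) :
    Nonempty (trivialModule 𝒯 ≅ restrict φ hφ (trivialModule 𝒜)) := by
  have := hA.nontrivial
  let I := RingHom.ker (GradedRing.projZeroRingHom 𝒯)
  let J := RingHom.ker (GradedRing.projZeroRingHom 𝒜)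
  let q : A →ₗ[A] (A ⧸ J) := Submodule.mkQ J
  let p : T →ₗ[T] (restrict φ hφ (trivialModule 𝒜)).carrier :=
    { toFun := fun t => q (φ t)
      map_add' := fun s t => by rw [map_add, map_add]; rfl
      map_smul' := fun s t => by
        rw [smul_eq_mul, map_mul, ← smul_eq_mul, map_smul]
        rfl }
  have hscalar (t : T) : ∃ c : k, GradedRing.proj 𝒯 0 t = algebraMap k T c := by
    have h : GradedRing.proj 𝒯 0 t ∈ 𝒯 0 := SetLike.coe_mem _
    rw [hT.zero_eq, Submodule.mem_one] at h
    exact h.imp fun c hc => hc.symm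
  have hker (t : T) : p t = 0 ↔ t ∈ I := by
    refine (Submodule.Quotient.mk_eq_zero J).trans ?_
    rw [RingHom.mem_ker, RingHom.mem_ker]
    change GradedRing.proj 𝒜 0 (φ t) = 0 ↔ GradedRing.proj 𝒯 0 t = 0
    rw [proj_zero_map φ hφ]
    obtain ⟨c, hc⟩ := hscalar t
    rw [hc, AlgHom.commutes]
    constructor
    · intro h
      rw [(map_eq_zero (algebraMap k A)).1 h, map_zero]
    · intro h
      have := congrArg φ h
      rwa [AlgHom.commutes, map_zero] at this
  let f : trivialModule 𝒯 ⟶ restrict φ hφ (trivialModule 𝒜) :=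
    mkHom (M := trivialModule 𝒯) (N := restrict φ hφ (trivialModule 𝒜))
      (Submodule.liftQ I p fun t ht => (hker t).2 ht) (by
        rintro n _ ⟨t, ht, rfl⟩
        refine ⟨φ t, ?_, rfl⟩
        cases n with
        | ofNat n => exact hφ n t ht
        | negSucc n =>
          exact (congrArg φ (show t = 0 from ht)).trans (map_zero φ))
  have hinj : Function.Injective (lin f) := by
    rw [injective_iff_map_eq_zero]
    intro x hx
    obtain ⟨t, rfl⟩ := Submodule.Quotient.mk_surjective I x
    exact (Submodule.Quotient.mk_eq_zero I).2 ((hker t).1 hx)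
  have hsurj : Function.Surjective (lin f) := by
    intro y
    obtain ⟨a, rfl⟩ := Submodule.Quotient.mk_surjective J y
    have h : GradedRing.proj 𝒜 0 a ∈ 𝒜 0 := SetLike.coe_mem _
    rw [hA.zero_eq, Submodule.mem_one] at h
    obtain ⟨c, hc⟩ := h
    refine ⟨Submodule.Quotient.mk (p := I) (algebraMap k T c), ?_⟩
    refine (Submodule.Quotient.eq J).2 ?_
    rw [AlgHom.commutes, hc, RingHom.mem_ker, map_sub, sub_eq_zero]
    exact DirectSum.decompose_of_mem_same 𝒜 (SetLike.coe_mem _)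
  have : Mono f := ⟨fun s t hst => hom_ext fun x => hinj (congrArg (fun r => lin r x) hst)⟩
  have : Epi f := epi_of_surjective f hsurj
  have := isIso_of_mono_of_epi f
  exact ⟨asIso f⟩

end TrivialRestrict

end GrMod

/-! ### Regularity -/

section Regularity

open GrMod

variable {k : Type w} {A : Type u} [Field k] [Ring A] [Algebra k A] {𝒜 : ℕ → Submodule k A}
  [GradedAlgebra 𝒜]

theorem torReg_le_iff (M : GrMod 𝒜) (x : EReal) :
    torReg M ≤ x ↔ ∀ (i : ℕ) (j : ℤ), ¬ TorVanishes M i j →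
      (((j : ℝ) - (i : ℝ) : ℝ) : EReal) ≤ x := by
  simp only [torReg, iSup_le_iff, not_subsingleton_iff_nontrivial]

theorem torDeg_sub_le_iff (M : GrMod 𝒜) (i : ℕ) (x : EReal) :
    torDeg M i - (i : EReal) ≤ x ↔ ∀ j : ℤ, ¬ TorVanishes M i j →
      (((j : ℝ) - (i : ℝ) : ℝ) : EReal) ≤ x := by
  have hi : ((i : ℕ) : EReal) = ((i : ℝ) : EReal) := rfl
  have key (y : EReal) : y - (i : EReal) ≤ x ↔ y ≤ x + (i : EReal) := by
    rw [hi]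
    exact EReal.sub_le_iff_le_add (Or.inl (EReal.coe_ne_bot _)) (Or.inl (EReal.coe_ne_top _))
  simp only [key, torDeg, iSup_le_iff, not_subsingleton_iff_nontrivial]
  refine forall_congr' fun j => forall_congr' fun _ => ?_
  rw [EReal.coe_sub, ← hi, key]

theorem le_torReg {M : GrMod 𝒜} {i : ℕ} {j : ℤ} (h : ¬ TorVanishes M i j) :
    (((j : ℝ) - (i : ℝ) : ℝ) : EReal) ≤ torReg M :=
  (torReg_le_iff M _).1 le_rfl i j h

theorem le_torDeg_sub {M : GrMod 𝒜} {i : ℕ} {j : ℤ} (h : ¬ TorVanishes M i j) :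
    (((j : ℝ) - (i : ℝ) : ℝ) : EReal) ≤ torDeg M i - (i : EReal) :=
  (torDeg_sub_le_iff M i _).1 le_rfl j h

theorem le_sup_torDeg_sub {M : GrMod 𝒜} {s i : ℕ} {j : ℤ} (hi : i ≤ s)
    (h : ¬ TorVanishes M i j) : (((j : ℝ) - (i : ℝ) : ℝ) : EReal) ≤
      (Finset.range (s + 1)).sup fun i => torDeg M i - (i : EReal) :=
  (le_torDeg_sub h).trans (Finset.le_sup (f := fun i : ℕ => torDeg M i - (i : EReal))
    (Finset.mem_range.2 (Nat.lt_succ_of_le hi)))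

theorem torReg_eq_sup (M : GrMod 𝒜) {g : ℕ} (h : ∀ i, g < i → ∀ j, TorVanishes M i j) :
    torReg M = (Finset.range (g + 1)).sup fun i => torDeg M i - (i : EReal) := by
  refine le_antisymm ((torReg_le_iff _ _).2 fun i j hij => ?_) (Finset.sup_le fun i _ => ?_)
  · exact le_sup_torDeg_sub (le_of_not_gt fun hi => hij (h i hi j)) hij
  · exact (torDeg_sub_le_iff _ _ _).2 fun j => le_torReg

end Regularity

theorem lemma4p3 {k : Type w} [Field k] {T A : Type u} [Ring T] [Algebra k T] [Ring A] [Algebra k A]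
    (𝒯 : ℕ → Submodule k T) [GradedAlgebra 𝒯] (𝒜 : ℕ → Submodule k A) [GradedAlgebra 𝒜]
    (hT : IsASRegular 𝒯) (hTnoeth : IsTwoSidedNoetherian T)
    (hA : IsConnectedGraded 𝒜) (hAnoeth : IsTwoSidedNoetherian A)
    (φ : T →ₐ[k] A) (hφ : ∀ (n : ℕ), ∀ t ∈ 𝒯 n, φ t ∈ 𝒜 n) (hfin : IsFiniteMap φ) :
    (∀ M : GrMod 𝒜, Module.Finite A M.carrier →
      torReg (GrMod.restrict φ hφ M) ≤
        torReg (GrMod.restrict φ hφ (GrMod.regular 𝒜)) + torReg M) ∧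
    (HasLinearResolution (GrMod.restrict φ hφ (GrMod.regular 𝒜)) →
      (∀ s : ℕ, torDeg (trivialModule 𝒯) s - (s : EReal) ≤
        (Finset.range (s + 1)).sup fun i => torDeg (trivialModule 𝒜) i - (i : EReal)) ∧
      (∀ s : ℕ, (s : WithBot ℕ∞) ≤ gradedGlobalDimension 𝒯 →
        ((Finset.range (s + 1)).sup fun i => torDeg (trivialModule 𝒜) i - (i : EReal)) =
          (Finset.range (s + 1)).sup fun i => torDeg (trivialModule 𝒯) i - (i : EReal)) ∧
      (∀ j : ℕ, gradedGlobalDimension 𝒯 < (j : WithBot ℕ∞) →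
        torDeg (trivialModule 𝒜) j - (j : EReal) ≤ torReg (trivialModule 𝒯)) ∧
      (∃ g : ℕ, gradedGlobalDimension 𝒯 = (g : WithBot ℕ∞) ∧ torReg (trivialModule 𝒯) =
        (Finset.range (g + 1)).sup fun i => torDeg (trivialModule 𝒯) i - (i : EReal)) ∧
      torReg (trivialModule 𝒜) = torReg (trivialModule 𝒯) ∧
      (IsKoszul 𝒜 ↔ IsKoszul 𝒯)) := by
  have := hAnoeth.1
  have := hTnoeth.1
  have := hT.connected.nontrivial
  refine ⟨fun M hM => (torReg_le_iff _ _).2 fun s j hsj => ?_, fun hlin => ?_⟩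
  · -- `j - s = (j - e - q) + (e - p)`, since `p + q = s`.
    obtain ⟨p, q, e, hpq, hp, hq⟩ := GrMod.exists_tor_of_tor_restrict φ hφ hA M hsj
    have heq : (((j : ℝ) - (s : ℝ) : ℝ) : EReal) =
        ((((j - e : ℤ) : ℝ) - (q : ℝ) : ℝ) : EReal) + (((e : ℝ) - (p : ℝ) : ℝ) : EReal) := by
      rw [← EReal.coe_add, EReal.coe_eq_coe_iff, ← hpq]
      push_cast
      ring
    rw [heq]
    exact add_le_add (le_torReg hq) (le_torReg hp)
  obtain ⟨iso⟩ := GrMod.nonempty_trivialModule_iso_restrict φ hφ hT.connected hA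
  have hlin' (i : ℕ) (j : ℤ)
      (h : ¬ GrMod.TorVanishes (GrMod.restrict φ hφ (GrMod.regular 𝒜)) i j) : j ≤ i := by
    by_contra hlt
    exact h (GrMod.torVanishes_of_hasLinearResolution hlin fun h' => hlt h'.le)
  have toA {s : ℕ} {j : ℤ} (h : ¬ GrMod.TorVanishes (trivialModule 𝒯) s j) :
      ∃ (i : ℕ) (e : ℤ), i ≤ s ∧ j - s ≤ e - i ∧ ¬ GrMod.TorVanishes (trivialModule 𝒜) i e := by
    obtain ⟨p, q, e, hpq, hp, hq⟩ := GrMod.exists_tor_of_tor_restrict φ hφ hA (trivialModule 𝒜)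
      (fun h' => h (GrMod.torVanishes_of_iso iso.symm h'))
    have := hlin' q _ hq
    exact ⟨p, e, by omega, by omega, hp⟩
  have toT {s : ℕ} {j : ℤ} (h : ¬ GrMod.TorVanishes (trivialModule 𝒜) s j) :
      ∃ (i : ℕ) (e : ℤ), i ≤ s ∧ j - s ≤ e - i ∧ ¬ GrMod.TorVanishes (trivialModule 𝒯) i e := by
    obtain ⟨i, e, hi, hle, h'⟩ := GrMod.exists_tor_restrict_of_tor φ hφ hA hlin' (trivialModule 𝒜) h
    exact ⟨i, e, hi, hle, fun h'' => h' (GrMod.torVanishes_of_iso iso h'')⟩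
  have coe_le {s i : ℕ} {j e : ℤ} (h : j - s ≤ e - i) :
      (((j : ℝ) - (s : ℝ) : ℝ) : EReal) ≤ (((e : ℝ) - (i : ℝ) : ℝ) : EReal) := by
    exact_mod_cast h
  have supT (s : ℕ) : torDeg (trivialModule 𝒯) s - (s : EReal) ≤
      (Finset.range (s + 1)).sup fun i => torDeg (trivialModule 𝒜) i - (i : EReal) :=
    (torDeg_sub_le_iff _ _ _).2 fun j hj => by
      obtain ⟨i, e, hi, hle, h⟩ := toA hj
      exact (coe_le hle).trans (le_sup_torDeg_sub hi h)
  have supA (s : ℕ) : torDeg (trivialModule 𝒜) s - (s : EReal) ≤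
      (Finset.range (s + 1)).sup fun i => torDeg (trivialModule 𝒯) i - (i : EReal) :=
    (torDeg_sub_le_iff _ _ _).2 fun j hj => by
      obtain ⟨i, e, hi, hle, h⟩ := toT hj
      exact (coe_le hle).trans (le_sup_torDeg_sub hi h)
  have mono {a b : ℕ} (hab : a ∈ Finset.range (b + 1)) :
      Finset.range (a + 1) ⊆ Finset.range (b + 1) :=
    Finset.range_mono (Finset.mem_range.1 hab)
  obtain ⟨g, hg⟩ := GrMod.exists_gradedGlobalDimension_eq 𝒯 hT.gradedGlobalDimension_lt_top
  refine ⟨supT, fun s _ => le_antisymm ?_ ?_, fun s _ => ?_, ⟨g, hg, ?_⟩, le_antisymm ?_ ?_, ?_⟩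
  · exact Finset.sup_le fun i hi => (supA i).trans (Finset.sup_mono (mono hi))
  · exact Finset.sup_le fun i hi => (supT i).trans (Finset.sup_mono (mono hi))
  · refine (torDeg_sub_le_iff _ _ _).2 fun j hj => ?_
    obtain ⟨i, e, -, hle, h⟩ := toT hj
    exact (coe_le hle).trans (le_torReg h)
  · exact torReg_eq_sup _ fun i hi => GrMod.torVanishes_of_gradedGlobalDimension_lt 𝒯 hg _ hi
  · refine (torReg_le_iff _ _).2 fun s j hj => ?_
    obtain ⟨i, e, -, hle, h⟩ := toT hj
    exact (coe_le hle).trans (le_torReg h)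
  · refine (torReg_le_iff _ _).2 fun s j hj => ?_
    obtain ⟨i, e, -, hle, h⟩ := toA hj
    exact (coe_le hle).trans (le_torReg h)
  · rw [GrMod.isKoszul_iff 𝒜 hA, GrMod.isKoszul_iff 𝒯 hT.connected]
    constructor
    · intro H s j hj
      obtain ⟨i, e, -, hle, h⟩ := toA hj
      have := H i e h
      omega
    · intro H s j hj
      obtain ⟨i, e, -, hle, h⟩ := toT hj
      have := H i e h
      omega
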